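/- \textbf{Proposition (top eigenvalue test).} There is a universal constant $C>0$ such that the following holds. Fix $\nu\in(0,1)$, let $p=p_n$ be a sequence of dimensions with $p\wedge n\to\infty$ as $n\to\infty$, let $\Sigma=\Sigma_n$ be known positive definite $p\times p$ matrices, and let $r_n>0$. For $\theta=(\nu',\mu_0,\mu_1,\Sigma)$ with $\nu'\in(0,1)$ and $\mu_0,\mu_1\in\mathbb R^p$, let $\mathbb P_\theta$ be the law of an i.i.d. sample $X_1,\dots,X_n$ from the mixture $\nu'\,\mathcal N(\mu_0,\Sigma)+(1-\nu')\,\mathcal N(\mu_1,\Sigma)$. Put $\Delta\mu=\mu_1-\mu_0$ and $R_0(\theta)=\Delta\mu^\top\Sigma^{-1}\Delta\mu$. Let $$\Omega_0(\Sigma)=\{\theta=(\nu',\mu,\mu,\Sigma):\ \nu'\in(0,1),\ \mu\in\mathbb R^p\}$$ (when the means agree, $\mathbb P_\theta$ does not depend on $\nu'$) and $$\Omega_1(\nu,\Sigma,R_0,r_n)=\{\theta=(\nu,\mu_0,\mu_1,\Sigma):\ \Delta\mu\text{ has at most } s \text{ nonzero entries},\ R_0(\theta)\ge r_n\},\qquad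 s=p,$$ so that the sparsity constraint is void. With $\bar X=\frac1n\sum_{i=1}^n X_i$ and $\hat\Sigma=\frac1n\sum_{i=1}^n(X_i-\bar X)(X_i-\bar X)^\top$, let $$T=\max_{\|u\|=1}u^\top\,\Sigma^{-1/2}\hat\Sigma\,\Sigma^{-1/2}u$$ be the top eigenvalue of the standardized sample covariance matrix, and let $\phi$ be the test that rejects when $T\ge 1+\frac pn+12\sqrt{\frac pn}$. If $$\liminf_{n\to\infty}\ r_n\,\nu(1-\nu)\sqrt{\frac np}\ \ge\ C,$$ then $\phi$ is asymptotically powerful, that is, $$\sup_{\theta\in\Omega_0(\Sigma)}\mathbb P_\theta(\phi=1)\;+\;\sup_{\theta\in\Omega_1(\nu,\Sigma,R_0,r_n)}\mathbb P_\theta(\phi=0)\ \longrightarrow\ 0\qquad(n\to\infty).$$ -/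

import Mathlib

open scoped MatrixOrder

noncomputable section

namespace GaussMix

/-- The parameter `θ = (ν, μ₀, μ₁, Σ)` of a two-component Gaussian mixture in dimension `p`. -/
structure Param (p : ℕ) where
  weight : ℝ
  mean0 : EuclideanSpace ℝ (Fin p)
  mean1 : EuclideanSpace ℝ (Fin p)
  cov : Matrix (Fin p) (Fin p) ℝ

namespace Param

variable {p : ℕ}

/-- The difference in means `Δμ = μ₁ - μ₀`. -/
def meanDiff (θ : Param p) : EuclideanSpace ℝ (Fin p) := θ.mean1 - θ.mean0

/-- The mixture `ν N(μ₀, Σ) + (1 - ν) N(μ₁, Σ)`. -/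
def mixture (θ : Param p) : MeasureTheory.Measure (EuclideanSpace ℝ (Fin p)) :=
  ENNReal.ofReal θ.weight • ProbabilityTheory.multivariateGaussian θ.mean0 θ.cov +
    ENNReal.ofReal (1 - θ.weight) • ProbabilityTheory.multivariateGaussian θ.mean1 θ.cov

/-- The law `P_θ` of an iid sample `X₁, …, Xₙ` from the mixture. -/
def sampleLaw (θ : Param p) (n : ℕ) :
    MeasureTheory.Measure (Fin n → EuclideanSpace ℝ (Fin p)) :=
  MeasureTheory.Measure.pi fun _ => θ.mixture

/-- The squared Mahalanobis signal-to-noise ratio `R₀(θ) = Δμᵀ Σ⁻¹ Δμ`. -/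
def mahalanobis (θ : Param p) : ℝ :=
  θ.meanDiff.ofLp ⬝ᵥ (θ.cov⁻¹.mulVec θ.meanDiff.ofLp)

end Param

/-- A vector is `s`-sparse if it has at most `s` nonzero entries. -/
def IsSparse {p : ℕ} (s : ℕ) (v : EuclideanSpace ℝ (Fin p)) : Prop :=
  {j | v j ≠ 0}.ncard ≤ s

/-- `Ω₀(Σ)`: equal means and covariance `Σ`; the weight is then an arbitrary number in `(0, 1)`,
which does not affect the law. -/
def nullSet {p : ℕ} (S : Matrix (Fin p) (Fin p) ℝ) : Set (Param p) :=
  {θ | θ.weight ∈ Set.Ioo (0 : ℝ) 1 ∧ θ.mean0 = θ.mean1 ∧ θ.cov = S}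

/-- `Ω₁(ν, Σ, R, r)` for sparsity `s`: weight `ν`, covariance `Σ`, `s`-sparse difference in means,
and `R(θ) ≥ r`. -/
def altSet {p : ℕ} (s : ℕ) (ν : ℝ) (S : Matrix (Fin p) (Fin p) ℝ) (R : Param p → ℝ) (r : ℝ) :
    Set (Param p) :=
  {θ | θ.weight = ν ∧ θ.cov = S ∧ IsSparse s θ.meanDiff ∧ r ≤ R θ}

/-- The worst-case risk of the test with rejection region `φ` (a set of samples of size `n`):
the supremum over `Ω₀` of the probabilities of rejecting plus the supremum over `Ω₁` of the
probabilities of not rejecting. -/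
def risk {n p : ℕ} (φ : Set (Fin n → EuclideanSpace ℝ (Fin p))) (Ω₀ Ω₁ : Set (Param p)) :
    ENNReal :=
  (⨆ θ ∈ Ω₀, θ.sampleLaw n φ) + ⨆ θ ∈ Ω₁, θ.sampleLaw n φᶜ

variable {n p : ℕ}

/-- The sample mean. -/
def sampleMean (X : Fin n → EuclideanSpace ℝ (Fin p)) : EuclideanSpace ℝ (Fin p) :=
  (n : ℝ)⁻¹ • ∑ i, X i

/-- The sample covariance matrix, normalized by `1 / n`. -/
def sampleCov (X : Fin n → EuclideanSpace ℝ (Fin p)) : Matrix (Fin p) (Fin p) ℝ :=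
  (n : ℝ)⁻¹ • ∑ i, Matrix.vecMulVec (X i - sampleMean X).ofLp (X i - sampleMean X).ofLp

/-- The standardized sample covariance matrix `Σ^{-1/2} Σ̂ Σ^{-1/2}`. -/
def standardizedCov (S : Matrix (Fin p) (Fin p) ℝ) (X : Fin n → EuclideanSpace ℝ (Fin p)) :
    Matrix (Fin p) (Fin p) ℝ :=
  (CFC.sqrt S)⁻¹ * sampleCov X * (CFC.sqrt S)⁻¹

/-- The largest value of `uᵀ A u` over Euclidean unit vectors `u`. -/
def topEigenvalue (A : Matrix (Fin p) (Fin p) ℝ) : ℝ :=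
  ⨆ u : {u : EuclideanSpace ℝ (Fin p) // ‖u‖ = 1}, u.1.ofLp ⬝ᵥ (A.mulVec u.1.ofLp)

/-- The top eigenvalue test, as a rejection region:
`T ≥ 1 + p / n + 12 √(p / n)` with `T` the top eigenvalue of `Σ^{-1/2} Σ̂ Σ^{-1/2}`. -/
def topEigenvalueTest (n : ℕ) {p : ℕ} (S : Matrix (Fin p) (Fin p) ℝ) :
    Set (Fin n → EuclideanSpace ℝ (Fin p)) :=
  {X | 1 + (p : ℝ) / n + 12 * Real.sqrt ((p : ℝ) / n) ≤ topEigenvalue (standardizedCov S X)}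

end GaussMix

end

open scoped Pointwise

open MeasureTheory ProbabilityTheory

namespace GaussMix

/-! Whitening by Σ^{-1/2} and conditioning on the labels reduce everything to Gaussian matrices. At
a unit vector u, n times the standardized form is the sum of ⟨u, Yᵢ - Ȳ⟩² with Yᵢ = zᵢ + xᵢ δ, where
zᵢ is standard Gaussian, xᵢ ∈ {0, 1} is the label and ‖δ‖² = R₀(θ). The rejection threshold becomes
n + p + 12√(pn).

Under the null δ = 0, and centering only decreases the form, so a bound n + p + 11√(pn) on the
squared top singular value of a Gaussian matrix is enough. By transposition the dimension a may be
taken at most the number b of rows. Instead of an ε-net, `measure_exists_centeredForm_gt_le`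
averages exponentials of the centered quadratic form over the unit ball: Markov bounds the average,
and `integral_exp_centeredForm_ge` shows that a large value at one unit vector makes the average
large, at a cost exponential in a only.

Under the alternative the spread D of the labels is at least nν(1-ν)/2 by Chebyshev, so ‖δ‖²D ≥
32√(pn). If p ≤ n, the direction of δ exceeds the threshold (`rowForm_shift_eq`). If n ≤ p, the
threshold contains a p that the noise in a fixed direction does not supply; the direction of ∑ vᵢ zᵢ
+ √D δ, with v the normalized centered labels, collects a noise term of size about p together with
the signal (`exists_rowForm_shift_ge`). Each failure probability is O(1 / (p ∧ n)) or O(1 / n), for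
fixed ν. -/

/-! ### Gaussian matrices and their transposes. -/

/-- The law of `b` independent standard Gaussian vectors in dimension `a`. -/
noncomputable def gaussianRows (b a : ℕ) : Measure (Fin b → EuclideanSpace ℝ (Fin a)) :=
  Measure.pi fun _ => stdGaussian (EuclideanSpace ℝ (Fin a))

instance (b a : ℕ) : IsProbabilityMeasure (gaussianRows b a) := by
  unfold gaussianRows; infer_instance

/-- The transpose of a matrix given by its rows. -/
def transposeRows {b a : ℕ} (g : Fin b → EuclideanSpace ℝ (Fin a)) :
    Fin a → EuclideanSpace ℝ (Fin b) :=
  fun j => WithLp.toLp 2 fun i => g i j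

lemma measurable_transposeRows {b a : ℕ} : Measurable (transposeRows (b := b) (a := a)) := by
  unfold transposeRows; fun_prop

lemma pi_pi_map_swap {X ι κ : Type*} [MeasurableSpace X] [Fintype ι] [Fintype κ] (μ : Measure X)
    [IsProbabilityMeasure μ] :
    (Measure.pi fun _ : ι => Measure.pi fun _ : κ => μ).map (fun x j i => x i j) =
      Measure.pi fun _ : κ => Measure.pi fun _ : ι => μ := by
  simp_rw [← Measure.infinitePi_eq_pi]
  rw [← Measure.infinitePi_map_curry (fun (_ : ι) (_ : κ) => μ),
    ← Measure.infinitePi_map_curry (fun (_ : κ) (_ : ι) => μ),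
    ← Measure.infinitePi_map_piCongrLeft (fun _ : κ × ι => μ) (Equiv.prodComm ι κ),
    Measure.map_map (by fun_prop) (by fun_prop), Measure.map_map (by fun_prop) (by fun_prop)]
  congr 1

lemma gaussianRows_eq_map (b a : ℕ) :
    gaussianRows b a = (Measure.pi fun _ : Fin b => Measure.pi fun _ : Fin a => gaussianReal 0 1).map
      fun x i => WithLp.toLp 2 (x i) := by
  rw [Measure.pi_map_pi (by fun_prop)]
  simp_rw [map_pi_eq_stdGaussian]
  rfl

lemma gaussianRows_map_transpose (b a : ℕ) :
    (gaussianRows b a).map transposeRows = gaussianRows a b := by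
  rw [gaussianRows_eq_map, gaussianRows_eq_map, ← pi_pi_map_swap (ι := Fin b) (κ := Fin a),
    Measure.map_map measurable_transposeRows (by fun_prop),
    Measure.map_map (by fun_prop) (by fun_prop)]
  rfl

/-! ### Laplace transform of the quadratic form at a fixed vector. -/

lemma integrable_exp_mul_sq_gaussianReal {l : ℝ} (hl : l < 1 / 2) :
    Integrable (fun t : ℝ => Real.exp (l * t ^ 2)) (gaussianReal 0 1) := by
  rw [gaussianReal_of_var_ne_zero _ one_ne_zero,
    integrable_withDensity_iff (measurable_gaussianPDF _ _) (by simp [gaussianPDF])]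
  refine ((integrable_exp_neg_mul_sq (b := 1 / 2 - l) (by linarith)).const_mul
    (√(2 * Real.pi * 1))⁻¹).congr (Filter.Eventually.of_forall fun t => ?_)
  simp only [toReal_gaussianPDF, gaussianPDFReal, NNReal.coe_one]
  rw [mul_left_comm, ← Real.exp_add]
  congr 2
  ring

lemma integral_exp_mul_sq_gaussianReal {l : ℝ} (hl : l < 1 / 2) :
    ∫ t, Real.exp (l * t ^ 2) ∂gaussianReal 0 1 = (√(1 - 2 * l))⁻¹ := by
  rw [integral_gaussianReal_eq_integral_smul one_ne_zero]
  have h : ∀ t : ℝ, gaussianPDFReal 0 1 t • Real.exp (l * t ^ 2) =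
      (√(2 * Real.pi))⁻¹ * Real.exp (-(1 / 2 - l) * t ^ 2) := fun t => by
    simp only [gaussianPDFReal, NNReal.coe_one, smul_eq_mul, mul_one]
    rw [mul_assoc, ← Real.exp_add]
    congr 2
    ring
  simp_rw [h]
  rw [integral_const_mul, integral_gaussian, ← Real.sqrt_inv, ← Real.sqrt_inv,
    ← Real.sqrt_mul (by positivity)]
  congr 1
  have := Real.pi_pos
  have h2 : 1 / 2 - l ≠ 0 := by linarith
  have h3 : 1 - 2 * l ≠ 0 := by linarith
  field_simp

lemma stdGaussian_map_inner {a : ℕ} (v : EuclideanSpace ℝ (Fin a)) :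
    (stdGaussian (EuclideanSpace ℝ (Fin a))).map (fun x => inner ℝ v x) =
      (gaussianReal 0 1).map (fun t => ‖v‖ * t) := by
  have h := IsGaussian.map_eq_gaussianReal (μ := stdGaussian (EuclideanSpace ℝ (Fin a)))
    (innerSL ℝ v)
  rw [integral_strongDual_stdGaussian, variance_dual_stdGaussian, innerSL_apply_norm] at h
  rw [gaussianReal_map_const_mul]
  simp only [mul_zero, mul_one]
  convert h using 2
  · ext; simp
  · exact (Real.toNNReal_of_nonneg (sq_nonneg _)).symm

/-- `∑ⱼ ⟨v, gⱼ⟩²`. -/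
noncomputable def rowForm {b a : ℕ} (g : Fin b → EuclideanSpace ℝ (Fin a))
    (v : EuclideanSpace ℝ (Fin a)) : ℝ :=
  ∑ j, (inner ℝ v (g j)) ^ 2

lemma integral_exp_mul_inner_sq {a : ℕ} (v : EuclideanSpace ℝ (Fin a)) {l : ℝ}
    (hl : l * ‖v‖ ^ 2 < 1 / 2) :
    Integrable (fun x => Real.exp (l * (inner ℝ v x) ^ 2)) (stdGaussian (EuclideanSpace ℝ (Fin a))) ∧
    ∫ x, Real.exp (l * (inner ℝ v x) ^ 2) ∂stdGaussian (EuclideanSpace ℝ (Fin a)) =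
      (√(1 - 2 * (l * ‖v‖ ^ 2)))⁻¹ := by
  have hm := stdGaussian_map_inner v
  have e : ∀ t : ℝ, Real.exp (l * (‖v‖ * t) ^ 2) = Real.exp (l * ‖v‖ ^ 2 * t ^ 2) := fun t => by
    ring_nf
  constructor
  · have : Integrable (fun t : ℝ => Real.exp (l * t ^ 2))
        ((stdGaussian (EuclideanSpace ℝ (Fin a))).map (fun x => inner ℝ v x)) := by
      rw [hm, integrable_map_measure (by fun_prop) (by fun_prop)]
      exact (integrable_exp_mul_sq_gaussianReal hl).congr
        (Filter.Eventually.of_forall fun t => (e t).symm)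
    exact this.comp_measurable (by fun_prop)
  · rw [← integral_exp_mul_sq_gaussianReal hl, ← integral_map (φ := fun x => inner ℝ v x)
      (f := fun t => Real.exp (l * t ^ 2)) (by fun_prop) (by fun_prop), hm,
      integral_map (by fun_prop) (by fun_prop)]
    simp_rw [e]

lemma integral_exp_mul_rowForm {b a : ℕ} (v : EuclideanSpace ℝ (Fin a)) {l : ℝ}
    (hl : l * ‖v‖ ^ 2 < 1 / 2) :
    Integrable (fun g => Real.exp (l * rowForm g v)) (gaussianRows b a) ∧
    ∫ g, Real.exp (l * rowForm g v) ∂gaussianRows b a = (√(1 - 2 * (l * ‖v‖ ^ 2)))⁻¹ ^ b := by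
  obtain ⟨h1, h2⟩ := integral_exp_mul_inner_sq v hl
  have e : ∀ g : Fin b → EuclideanSpace ℝ (Fin a), Real.exp (l * rowForm g v) =
      ∏ j, Real.exp (l * (inner ℝ v (g j)) ^ 2) := fun g => by
    rw [rowForm, Finset.mul_sum, Real.exp_sum]
  simp_rw [e]
  refine ⟨Integrable.fintype_prod (f := fun _ x => Real.exp (l * (inner ℝ v x) ^ 2)) fun _ => h1, ?_⟩
  rw [gaussianRows, integral_fintype_prod_eq_prod (f := fun _ x => Real.exp (l * (inner ℝ v x) ^ 2))]
  simp [h2]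

/-- `∑ⱼ ⟨v, gⱼ⟩² - b ‖v‖²`, the centered version of `rowForm`. -/
noncomputable def centeredForm {b a : ℕ} (g : Fin b → EuclideanSpace ℝ (Fin a))
    (v : EuclideanSpace ℝ (Fin a)) : ℝ :=
  rowForm g v - b * ‖v‖ ^ 2

lemma lintegral_exp_mul_centeredForm {b a : ℕ} (v : EuclideanSpace ℝ (Fin a)) {l : ℝ}
    (hl : l * ‖v‖ ^ 2 < 1 / 2) :
    ∫⁻ g, ENNReal.ofReal (Real.exp (l * centeredForm g v)) ∂gaussianRows b a =
      ENNReal.ofReal (Real.exp (b * (-(l * ‖v‖ ^ 2) - Real.log (1 - 2 * (l * ‖v‖ ^ 2)) / 2))) := by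
  obtain ⟨h1, h2⟩ := integral_exp_mul_rowForm (b := b) v hl
  have e : ∀ g : Fin b → EuclideanSpace ℝ (Fin a), Real.exp (l * centeredForm g v) =
      Real.exp (-(b * (l * ‖v‖ ^ 2))) * Real.exp (l * rowForm g v) := fun g => by
    rw [← Real.exp_add, centeredForm]; ring_nf
  simp_rw [e]
  rw [← ofReal_integral_eq_lintegral_ofReal (h1.const_mul _)
    (Filter.Eventually.of_forall fun g => by positivity), integral_const_mul, h2]
  congr 1
  have h3 : 0 < 1 - 2 * (l * ‖v‖ ^ 2) := by linarith
  have : (√(1 - 2 * (l * ‖v‖ ^ 2)))⁻¹ = Real.exp (- Real.log (1 - 2 * (l * ‖v‖ ^ 2)) / 2) := by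
    rw [Real.sqrt_eq_rpow, ← Real.rpow_neg h3.le, Real.rpow_def_of_pos h3]
    ring_nf
  rw [this, ← Real.exp_nat_mul, ← Real.exp_add]
  ring_nf

/-- This is x ≤ sinh x at x = -log(1 - 2l). -/
lemma neg_sub_log_half_le {l : ℝ} (h0 : 0 ≤ l) (h1 : l < 1 / 2) :
    -l - Real.log (1 - 2 * l) / 2 ≤ l ^ 2 / (1 - 2 * l) := by
  have hp : 0 < 1 - 2 * l := by linarith
  have ht : 0 ≤ - Real.log (1 - 2 * l) := by
    have := Real.log_nonpos hp.le (by linarith); linarith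
  have h := Real.self_le_sinh_iff.2 ht
  rw [Real.sinh_eq, neg_neg, Real.exp_neg, Real.exp_log hp] at h
  have e : l ^ 2 / (1 - 2 * l) = ((1 - 2 * l)⁻¹ - (1 - 2 * l)) / 4 - l := by
    rw [div_eq_iff hp.ne']
    linear_combination (-1 / 4 : ℝ) * mul_inv_cancel₀ hp.ne'
  rw [e]; linarith

lemma sub_log_half_le {s : ℝ} (hs : 0 ≤ s) : s - Real.log (1 + 2 * s) / 2 ≤ s ^ 2 := by
  have h := Real.le_log_one_add_of_nonneg (x := 2 * s) (by linarith)
  have h2 : 2 * s - 2 * s ^ 2 ≤ 2 * (2 * s) / (2 * s + 2) := by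
    rw [le_div_iff₀ (by linarith)]; nlinarith [mul_nonneg hs (sq_nonneg s)]
  linarith

lemma lintegral_exp_mul_centeredForm_le {b a : ℕ} {v : EuclideanSpace ℝ (Fin a)} (hv : ‖v‖ ≤ 1)
    {l : ℝ} (h0 : 0 ≤ l) (h1 : l < 1 / 2) :
    ∫⁻ g, ENNReal.ofReal (Real.exp (l * centeredForm g v)) ∂gaussianRows b a ≤
      ENNReal.ofReal (Real.exp (b * (l ^ 2 / (1 - 2 * l)))) := by
  have hv2 : ‖v‖ ^ 2 ≤ 1 := pow_le_one₀ (norm_nonneg _) hv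
  have hlv : l * ‖v‖ ^ 2 ≤ l := mul_le_of_le_one_right h0 hv2
  have hlv0 : 0 ≤ l * ‖v‖ ^ 2 := by positivity
  rw [lintegral_exp_mul_centeredForm v (by linarith)]
  gcongr
  refine (neg_sub_log_half_le hlv0 (by linarith)).trans ?_
  have : 0 < 1 - 2 * l := by linarith
  gcongr

lemma lintegral_exp_neg_mul_centeredForm_le {b a : ℕ} {v : EuclideanSpace ℝ (Fin a)} (hv : ‖v‖ ≤ 1)
    {s : ℝ} (h0 : 0 ≤ s) :
    ∫⁻ g, ENNReal.ofReal (Real.exp (-s * centeredForm g v)) ∂gaussianRows b a ≤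
      ENNReal.ofReal (Real.exp (b * s ^ 2)) := by
  have hv2 : ‖v‖ ^ 2 ≤ 1 := pow_le_one₀ (norm_nonneg _) hv
  have hlv : s * ‖v‖ ^ 2 ≤ s := mul_le_of_le_one_right h0 hv2
  have hlv0 : 0 ≤ s * ‖v‖ ^ 2 := by positivity
  rw [lintegral_exp_mul_centeredForm v (by linarith)]
  gcongr
  have := sub_log_half_le hlv0
  have h3 : (s * ‖v‖ ^ 2) ^ 2 ≤ s ^ 2 := by gcongr
  rw [show -(-s * ‖v‖ ^ 2) = s * ‖v‖ ^ 2 by ring,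
    show 1 - 2 * (-s * ‖v‖ ^ 2) = 1 + 2 * (s * ‖v‖ ^ 2) by ring]
  linarith

/-! ### Uniform upper bound on the sphere by averaging over a ball. -/

lemma continuous_centeredForm {b a : ℕ} (g : Fin b → EuclideanSpace ℝ (Fin a)) :
    Continuous (centeredForm g) := by
  unfold centeredForm rowForm; fun_prop

/-- The parallelogram law for `centeredForm`. -/
lemma centeredForm_add_add_sub {b a : ℕ} (g : Fin b → EuclideanSpace ℝ (Fin a))
    (v w : EuclideanSpace ℝ (Fin a)) :
    centeredForm g (v + w) + centeredForm g (v - w) = 2 * centeredForm g v + 2 * centeredForm g w := by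
  have h := parallelogram_law_with_norm ℝ v w
  have h2 : rowForm g (v + w) + rowForm g (v - w) = 2 * rowForm g v + 2 * rowForm g w := by
    simp only [rowForm, inner_add_left, inner_sub_left, Finset.mul_sum, ← Finset.sum_add_distrib]
    exact Finset.sum_congr rfl fun j _ => by ring
  simp only [centeredForm]
  linear_combination h2 - (b : ℝ) * h

lemma centeredForm_smul {b a : ℕ} (g : Fin b → EuclideanSpace ℝ (Fin a)) (c : ℝ)
    (v : EuclideanSpace ℝ (Fin a)) : centeredForm g (c • v) = c ^ 2 * centeredForm g v := by
  simp only [centeredForm, rowForm, real_inner_smul_left, norm_smul, mul_pow, Real.norm_eq_abs,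
    sq_abs, mul_sub, Finset.mul_sum]
  ring

lemma integral_closedBall_neg {a : ℕ} (f : EuclideanSpace ℝ (Fin a) → ℝ) :
    ∫ w in Metric.closedBall (0 : EuclideanSpace ℝ (Fin a)) 1, f (-w) =
      ∫ w in Metric.closedBall (0 : EuclideanSpace ℝ (Fin a)) 1, f w := by
  have h := (Measure.measurePreserving_neg
    (volume : Measure (EuclideanSpace ℝ (Fin a)))).setIntegral_preimage_emb
      (MeasurableEquiv.neg _).measurableEmbedding f (Metric.closedBall 0 1)
  rw [← h]
  congr 2
  ext; simp

/-- Substitute v = u + εw: the Jacobian is ε^a, and the small ball around u stays inside the unit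
ball. -/
lemma integral_closedBall_smul_add_le {a : ℕ} {f : EuclideanSpace ℝ (Fin a) → ℝ}
    (hf : Continuous f) (hf0 : ∀ v, 0 ≤ f v) {c ε : ℝ} (hε : 0 < ε)
    {u : EuclideanSpace ℝ (Fin a)} (hu : ‖u‖ ≤ c) (hc : c + ε ≤ 1) :
    ε ^ a * ∫ w in Metric.closedBall (0 : EuclideanSpace ℝ (Fin a)) 1, f (u + ε • w) ≤
      ∫ v in Metric.closedBall (0 : EuclideanSpace ℝ (Fin a)) 1, f v := by
  rw [Measure.setIntegral_comp_smul_of_pos volume (fun w => f (u + w)) _ hε]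
  have hball : ε • Metric.closedBall (0 : EuclideanSpace ℝ (Fin a)) 1 = Metric.closedBall 0 ε := by
    rw [smul_closedBall _ _ zero_le_one]; simp [abs_of_pos hε]
  have h := (measurePreserving_add_left
    (volume : Measure (EuclideanSpace ℝ (Fin a))) u).setIntegral_preimage_emb
      (MeasurableEquiv.addLeft u).measurableEmbedding f (Metric.closedBall u ε)
  have hp : (fun x => u + x) ⁻¹' Metric.closedBall u ε = Metric.closedBall 0 ε := by
    ext; simp [dist_eq_norm]
  rw [hp] at h
  rw [hball, h, finrank_euclideanSpace_fin, smul_eq_mul, mul_inv_cancel_left₀ (by positivity)]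
  refine setIntegral_mono_set (hf.continuousOn.integrableOn_compact (isCompact_closedBall _ _))
    (Filter.Eventually.of_forall hf0) (LE.le.eventuallyLE ?_)
  exact Metric.closedBall_subset_closedBall' (by rw [dist_zero_right]; linarith)

/-- Averaging the exponential of a quadratic form over a small ball around a multiple of a unit
vector bounds the form at that vector. -/
lemma integral_exp_centeredForm_ge {b a : ℕ} (g : Fin b → EuclideanSpace ℝ (Fin a))
    {v₀ : EuclideanSpace ℝ (Fin a)} (hv : ‖v₀‖ = 1) (θ : ℝ) {K : ℝ} (hK : 0 < K)
    (hint : ∫ w in Metric.closedBall (0 : EuclideanSpace ℝ (Fin a)) 1,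
      Real.exp (-(θ / 16) * centeredForm g w) ≤
        volume.real (Metric.closedBall (0 : EuclideanSpace ℝ (Fin a)) 1) * K) :
    (1 / 4) ^ a * (Real.exp (θ * (9 / 16) * centeredForm g v₀) *
      (volume.real (Metric.closedBall (0 : EuclideanSpace ℝ (Fin a)) 1) / K)) ≤
    ∫ v in Metric.closedBall (0 : EuclideanSpace ℝ (Fin a)) 1,
      Real.exp (θ * centeredForm g v) := by
  have hc := continuous_centeredForm g
  set B := Metric.closedBall (0 : EuclideanSpace ℝ (Fin a)) 1 with hB
  have hI : ∀ f : EuclideanSpace ℝ (Fin a) → ℝ, Continuous f → IntegrableOn f B := fun f hf =>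
    hf.continuousOn.integrableOn_compact (isCompact_closedBall _ _)
  refine le_trans ?_ (integral_closedBall_smul_add_le (f := fun v => Real.exp (θ * centeredForm g v))
    (by fun_prop) (fun v => (Real.exp_pos _).le) (c := 3 / 4) (ε := 1 / 4) (by norm_num)
    (u := (3 / 4 : ℝ) • v₀) (by rw [norm_smul, hv]; norm_num) (by norm_num))
  refine mul_le_mul_of_nonneg_left ?_ (by positivity)
  set f := fun w => Real.exp (θ * centeredForm g ((3 / 4 : ℝ) • v₀ + (1 / 4 : ℝ) • w)) with hf
  have hfc : Continuous f := by fun_prop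
  have hsym : ∫ w in B, f w = ∫ w in B, (f w + f (-w)) / 2 := by
    rw [integral_div, integral_add (hI _ hfc) (hI _ (by fun_prop)), integral_closedBall_neg]
    ring
  change _ ≤ ∫ w in B, f w
  rw [hsym]
  -- Pairing w with -w removes the cross term: AM-GM and the parallelogram law give e^(A+h), with
  -- 9/16 = (3/4)² and 1/16 = (1/4)². Then e^h ≥ 2/K - e^(-h)/K², which is (K e^h - 1)² ≥ 0, turns
  -- the upper bound on the integral of e^(-h) into a lower bound on that of e^h.
  have hpt : ∀ w, Real.exp (θ * (9 / 16) * centeredForm g v₀) *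
      (2 / K - Real.exp (-(θ / 16) * centeredForm g w) / K ^ 2) ≤ (f w + f (-w)) / 2 := fun w => by
    set A := θ * (9 / 16) * centeredForm g v₀
    set h := (θ / 16) * centeredForm g w with hh
    have hsum := centeredForm_add_add_sub g ((3 / 4 : ℝ) • v₀) ((1 / 4 : ℝ) • w)
    rw [centeredForm_smul, centeredForm_smul] at hsum
    have h1 : Real.exp (A + h) ≤ (f w + f (-w)) / 2 := by
      simp only [hf, smul_neg, ← sub_eq_add_neg]
      set x := θ * centeredForm g ((3 / 4 : ℝ) • v₀ + (1 / 4 : ℝ) • w) with hx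
      set y := θ * centeredForm g ((3 / 4 : ℝ) • v₀ - (1 / 4 : ℝ) • w) with hy
      have hxy : A + h = x / 2 + y / 2 := by
        simp only [A, h, hx, hy]; linear_combination -(θ / 2) * hsum
      rw [hxy, Real.exp_add]
      have e1 : Real.exp x = Real.exp (x / 2) ^ 2 := by rw [← Real.exp_nat_mul]; ring_nf
      have e2 : Real.exp y = Real.exp (y / 2) ^ 2 := by rw [← Real.exp_nat_mul]; ring_nf
      rw [e1, e2]
      nlinarith [sq_nonneg (Real.exp (x / 2) - Real.exp (y / 2))]
    refine le_trans ?_ h1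
    rw [Real.exp_add]
    refine mul_le_mul_of_nonneg_left ?_ (Real.exp_pos _).le
    rw [show -(θ / 16) * centeredForm g w = -h by rw [hh]; ring, Real.exp_neg]
    have := Real.exp_pos h
    rw [sub_le_iff_le_add]
    have h3 : 0 ≤ (K * Real.exp h - 1) ^ 2 / (K ^ 2 * Real.exp h) := by positivity
    have h4 : (K * Real.exp h - 1) ^ 2 / (K ^ 2 * Real.exp h) =
      Real.exp h + (Real.exp h)⁻¹ / K ^ 2 - 2 / K := by field_simp; ring
    linarith
  refine le_trans ?_ (integral_mono (μ := volume.restrict B) (hI _ (by fun_prop))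
    (hI _ (by fun_prop)) hpt)
  rw [integral_const_mul]
  refine mul_le_mul_of_nonneg_left ?_ (Real.exp_pos _).le
  rw [integral_sub (hI _ (by fun_prop)) (hI _ (by fun_prop))]
  simp only [integral_const, smul_eq_mul, measureReal_restrict_apply_univ]
  have : (∫ w in B, Real.exp (-(θ / 16) * centeredForm g w)) / K ^ 2 ≤ volume.real B / K := by
    rw [div_le_div_iff₀ (by positivity) hK]
    nlinarith
  have hd : ∫ w in B, Real.exp (-(θ / 16) * centeredForm g w) / K ^ 2 =
      (∫ w in B, Real.exp (-(θ / 16) * centeredForm g w)) / K ^ 2 := integral_div _ _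
  have e : volume.real B * (2 / K) = volume.real B / K + volume.real B / K := by ring
  rw [hd]
  linarith

/-- Fubini moves the expectation inside the ball average, where the hypothesis applies pointwise;
Markov concludes. -/
lemma measure_ball_average_ge_le {b a : ℕ} {l A : ℝ} (τ : ℝ)
    (h : ∀ v : EuclideanSpace ℝ (Fin a), ‖v‖ ≤ 1 →
      ∫⁻ g, ENNReal.ofReal (Real.exp (l * centeredForm g v)) ∂gaussianRows b a ≤
        ENNReal.ofReal (Real.exp A)) :
    gaussianRows b a {g | volume.real (Metric.closedBall (0 : EuclideanSpace ℝ (Fin a)) 1) *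
        Real.exp (A + τ) ≤ ∫ v in Metric.closedBall (0 : EuclideanSpace ℝ (Fin a)) 1,
          Real.exp (l * centeredForm g v)} ≤ ENNReal.ofReal (Real.exp (-τ)) := by
  set B := Metric.closedBall (0 : EuclideanSpace ℝ (Fin a)) 1
  have hBfin : volume B ≠ ⊤ := (isCompact_closedBall _ _).measure_ne_top
  have hBpos : volume B ≠ 0 := (Metric.measure_closedBall_pos volume _ one_pos).ne'
  have hV : 0 < volume.real B := ENNReal.toReal_pos hBpos hBfin
  have hmeas : Measurable fun z : (Fin b → EuclideanSpace ℝ (Fin a)) × EuclideanSpace ℝ (Fin a) =>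
      ENNReal.ofReal (Real.exp (l * centeredForm z.1 z.2)) := by
    unfold centeredForm rowForm
    fun_prop
  set F : (Fin b → EuclideanSpace ℝ (Fin a)) → ENNReal := fun g =>
    ∫⁻ v in B, ENNReal.ofReal (Real.exp (l * centeredForm g v)) with hF
  have hFm : Measurable F := hmeas.lintegral_prod_right'
  have hFi : ∀ g, F g = ENNReal.ofReal (∫ v in B, Real.exp (l * centeredForm g v)) := fun g => by
    rw [ofReal_integral_eq_lintegral_ofReal _ (Filter.Eventually.of_forall fun v => by positivity)]
    have := continuous_centeredForm g
    exact ContinuousOn.integrableOn_compact (isCompact_closedBall _ _) (by fun_prop)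
  have hE : ∫⁻ g, F g ∂gaussianRows b a ≤ ENNReal.ofReal (volume.real B * Real.exp A) := by
    simp only [hF]
    rw [lintegral_lintegral_swap (by exact hmeas.aemeasurable)]
    calc _ ≤ ∫⁻ v in B, ENNReal.ofReal (Real.exp A) :=
          setLIntegral_mono' Metric.isClosed_closedBall.measurableSet fun v hv =>
            h v (mem_closedBall_zero_iff.1 hv)
      _ = _ := by
          rw [setLIntegral_const, mul_comm (volume.real B), ENNReal.ofReal_mul (Real.exp_pos _).le,
            measureReal_def, ENNReal.ofReal_toReal hBfin]
  have hset : {g : Fin b → EuclideanSpace ℝ (Fin a) | volume.real B * Real.exp (A + τ) ≤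
      ∫ v in B, Real.exp (l * centeredForm g v)} ⊆
      {g | ENNReal.ofReal (volume.real B * Real.exp (A + τ)) ≤ F g} := fun g hg => by
    simp only [Set.mem_ofPred_eq, hFi] at hg ⊢
    exact ENNReal.ofReal_le_ofReal hg
  refine (measure_mono hset).trans ((meas_ge_le_lintegral_div hFm.aemeasurable
    (by simpa using ⟨hV, Real.exp_pos _⟩) ENNReal.ofReal_ne_top).trans ?_)
  refine (ENNReal.div_le_div_right hE _).trans ?_
  rw [← ENNReal.ofReal_div_of_pos (by positivity)]
  refine ENNReal.ofReal_le_ofReal (le_of_eq ?_)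
  rw [Real.exp_add, Real.exp_neg]
  field_simp

/-- Outside two events of probability e^(-a/8) each, the ball averages with parameters θ and -θ/16
are both controlled. The second supplies the K of `integral_exp_centeredForm_ge`, and the first then
bounds the form at every unit vector. -/
lemma measure_exists_centeredForm_gt_le {b a : ℕ} (ha : 0 < a) (hab : a ≤ b) :
    gaussianRows b a {g | ∃ v, ‖v‖ = 1 ∧ (a : ℝ) + 11 * √(a * b) < centeredForm g v} ≤
      2 * ENNReal.ofReal (Real.exp (-(a / 8 : ℝ))) := by
  have ha' : (0 : ℝ) < a := by exact_mod_cast ha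
  have hab' : (a : ℝ) ≤ b := by exact_mod_cast hab
  have hb' : (0 : ℝ) < b := ha'.trans_le hab'
  obtain ⟨r, hr, hr2⟩ : ∃ r : ℝ, 0 < r ∧ r ^ 2 = a := ⟨√a, by positivity, Real.sq_sqrt ha'.le⟩
  obtain ⟨t, ht, ht2⟩ : ∃ t : ℝ, 0 < t ∧ t ^ 2 = b := ⟨√b, by positivity, Real.sq_sqrt hb'.le⟩
  have hrt : r ≤ t := by
    rw [← hr2, ← ht2] at hab'
    exact (sq_le_sq₀ hr.le ht.le).1 hab'
  have hs : √((a : ℝ) * b) = r * t := by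
    rw [← hr2, ← ht2, ← mul_pow, Real.sqrt_sq (by positivity)]
  -- With r = √a and t = √b, this choice makes bθ²/(1 - 2θ) equal to θ√(ab).
  set θ := r / (t + 2 * r) with hθ
  have hθ0 : 0 < θ := by positivity
  have hθ1 : θ < 1 / 2 := by rw [hθ, div_lt_div_iff₀ (by positivity) two_pos]; linarith
  set B := Metric.closedBall (0 : EuclideanSpace ℝ (Fin a)) 1
  have hV : 0 < volume.real B := ENNReal.toReal_pos
    (Metric.measure_closedBall_pos volume _ one_pos).ne' (isCompact_closedBall _ _).measure_ne_top
  have h1 := measure_ball_average_ge_le (b := b) (a / 8 : ℝ)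
    (fun v hv => lintegral_exp_mul_centeredForm_le (b := b) (a := a) (v := v) hv hθ0.le hθ1)
  have h2 := measure_ball_average_ge_le (b := b) (a / 8 : ℝ)
    (fun v hv => lintegral_exp_neg_mul_centeredForm_le (b := b) (a := a) (v := v) hv
      (s := θ / 16) (by positivity))
  rw [two_mul]
  refine le_trans ?_ ((measure_union_le _ _).trans (add_le_add h1 h2))
  refine measure_mono fun g hg => ?_
  obtain ⟨v, hv, hgv⟩ := hg
  by_contra hcon
  simp only [Set.mem_union, Set.mem_ofPred_eq, not_or, not_le] at hcon
  obtain ⟨c1, c2⟩ := hcon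
  have h3 := (integral_exp_centeredForm_ge g hv θ (Real.exp_pos _) c2.le).trans_lt c1
  have hlog : ((1 : ℝ) / 4) ^ a = Real.exp (-(a * (2 * Real.log 2))) := by
    rw [← mul_neg, Real.exp_nat_mul, Real.exp_neg, two_mul, Real.exp_add, Real.exp_log two_pos]
    norm_num
  rw [hlog, div_eq_mul_inv (volume.real _), ← Real.exp_neg, mul_comm (volume.real _), ← mul_assoc, ← mul_assoc,
    mul_comm _ (volume.real _), mul_lt_mul_iff_right₀ hV, ← Real.exp_add, ← Real.exp_add,
    Real.exp_lt_exp] at h3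
  have e1 : (b : ℝ) * (θ ^ 2 / (1 - 2 * θ)) = θ * (r * t) := by
    have : 1 - 2 * θ = t / (t + 2 * r) := by rw [hθ]; field_simp; ring
    rw [this, hθ, ← ht2]; field_simp
  have e2 : (b : ℝ) * (θ / 16) ^ 2 ≤ a / 256 := by
    have : θ ≤ r / t := by rw [hθ]; gcongr; linarith
    have h5 : θ ^ 2 ≤ (r / t) ^ 2 := pow_le_pow_left₀ hθ0.le this 2
    clear_value θ
    rw [div_pow r t, hr2, ht2, le_div_iff₀ hb'] at h5
    nlinarith
  have e3 : (a : ℝ) = θ * (r * t + 2 * r ^ 2) := by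
    rw [hθ, ← hr2]; field_simp
  have hl2 := Real.log_two_lt_d9
  rw [hs] at hgv
  rw [e1] at h3
  have h6 : (a : ℝ) * (2 * Real.log 2) ≤ a * 1.3863 := by
    refine mul_le_mul_of_nonneg_left ?_ ha'.le; linarith
  -- The factor 1.65 exceeds 2 log 2 + 1/8 + 1/8 + 1/256: the volume factor 4^(-a), the two Markov
  -- deviations and the bound `e2`.
  have h7 : θ * ((9 / 16) * centeredForm g v) < θ * (r * t + 1.65 * (r * t + 2 * r ^ 2)) := by
    have : (1.65 : ℝ) * a = θ * (1.65 * (r * t + 2 * r ^ 2)) := by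
      conv_lhs => rw [e3]
      ring
    nlinarith
  have h8 := lt_of_mul_lt_mul_left h7 hθ0.le
  nlinarith [mul_le_mul_of_nonneg_left hrt hr.le]

/-! ### Algebra of transposes and sample means. -/

lemma rowForm_transposeRows {b a : ℕ} (g : Fin b → EuclideanSpace ℝ (Fin a))
    (w : EuclideanSpace ℝ (Fin b)) : rowForm (transposeRows g) w = ‖∑ i, w i • g i‖ ^ 2 := by
  rw [EuclideanSpace.real_norm_sq_eq]
  simp [rowForm, transposeRows, PiLp.inner_apply, mul_comm]

lemma rowForm_smul {b a : ℕ} (g : Fin b → EuclideanSpace ℝ (Fin a)) (c : ℝ)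
    (v : EuclideanSpace ℝ (Fin a)) : rowForm g (c • v) = c ^ 2 * rowForm g v := by
  simp only [rowForm, real_inner_smul_left, mul_pow, Finset.mul_sum]

/-- The form of the transpose is at least as large, somewhere on the unit sphere. -/
lemma exists_rowForm_transposeRows_ge {b a : ℕ} (g : Fin b → EuclideanSpace ℝ (Fin a))
    {u : EuclideanSpace ℝ (Fin a)} (hu : ‖u‖ = 1) (hpos : 0 < rowForm g u) :
    ∃ v, ‖v‖ = 1 ∧ rowForm g u ≤ rowForm (transposeRows g) v := by
  -- With G the matrix of rows, the witness is Gu normalized: ‖GᵀGu‖ ≥ ⟨u, GᵀGu⟩ = ‖Gu‖².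
  set w : EuclideanSpace ℝ (Fin b) := WithLp.toLp 2 fun i => inner ℝ u (g i) with hw
  have hw2 : ‖w‖ ^ 2 = rowForm g u := by
    rw [EuclideanSpace.real_norm_sq_eq]; rfl
  have hw0 : 0 < ‖w‖ := by
    refine lt_of_le_of_ne (norm_nonneg _) fun h0 => ?_
    rw [← hw2, ← h0] at hpos
    simp at hpos
  refine ⟨‖w‖⁻¹ • w, by rw [norm_smul, norm_inv, norm_norm, inv_mul_cancel₀ hw0.ne'], ?_⟩
  rw [rowForm_smul, rowForm_transposeRows, inv_pow, hw2, ← div_eq_inv_mul, le_div_iff₀ hpos]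
  have h1 : inner ℝ u (∑ i, w i • g i) = rowForm g u := by
    simp only [inner_sum, real_inner_smul_right, rowForm, hw, sq]
  have h2 := abs_real_inner_le_norm u (∑ i, w i • g i)
  rw [hu, one_mul, h1, abs_of_pos hpos] at h2
  nlinarith

lemma rowForm_le {b a : ℕ} (g : Fin b → EuclideanSpace ℝ (Fin a))
    {u : EuclideanSpace ℝ (Fin a)} (hu : ‖u‖ = 1) : rowForm g u ≤ ∑ j, ‖g j‖ ^ 2 := by
  refine Finset.sum_le_sum fun j _ => ?_
  have h := abs_real_inner_le_norm u (g j)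
  rw [hu, one_mul] at h
  rw [← sq_abs]
  gcongr

lemma sampleMean_inner {n p : ℕ} (Y : Fin n → EuclideanSpace ℝ (Fin p))
    (u : EuclideanSpace ℝ (Fin p)) :
    inner ℝ u (sampleMean Y) = (n : ℝ)⁻¹ * ∑ i, inner ℝ u (Y i) := by
  simp [sampleMean, real_inner_smul_right, inner_sum]

lemma sum_sub_mean_sq {n : ℕ} (y : Fin n → ℝ) :
    ∑ i, (y i - (n : ℝ)⁻¹ * ∑ j, y j) ^ 2 = ∑ i, y i ^ 2 - (n : ℝ)⁻¹ * (∑ j, y j) ^ 2 := by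
  rcases Nat.eq_zero_or_pos n with rfl | hn
  · simp
  have hn' : (n : ℝ) ≠ 0 := by positivity
  simp only [sub_sq, Finset.sum_add_distrib, Finset.sum_sub_distrib, Finset.sum_const,
    Finset.card_univ, Fintype.card_fin, nsmul_eq_mul, ← Finset.sum_mul, ← Finset.mul_sum]
  field_simp
  ring

lemma sampleMean_add_const {n p : ℕ} (hn : 0 < n) (Y : Fin n → EuclideanSpace ℝ (Fin p))
    (c : EuclideanSpace ℝ (Fin p)) : sampleMean (fun i => c + Y i) = c + sampleMean Y := by
  have hn' : (n : ℝ) ≠ 0 := by positivity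
  simp [sampleMean, Finset.sum_add_distrib, smul_add, ← Nat.cast_smul_eq_nsmul ℝ, smul_smul, hn']

/-- Centering at the sample mean decreases the form. -/
lemma rowForm_sub_sampleMean_le {n p : ℕ} (Y : Fin n → EuclideanSpace ℝ (Fin p))
    (u : EuclideanSpace ℝ (Fin p)) :
    rowForm (fun i => Y i - sampleMean Y) u ≤ rowForm Y u := by
  simp only [rowForm, inner_sub_right, sampleMean_inner]
  rw [sum_sub_mean_sq]
  have : 0 ≤ (n : ℝ)⁻¹ * (∑ j, inner ℝ u (Y j)) ^ 2 := by positivity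
  linarith

/-! ### Whitening, and the test in terms of the quadratic form. -/

section Whitening

variable {p : ℕ} {S : Matrix (Fin p) (Fin p) ℝ}

/-- Multiplication by `Σ^{-1/2}`. -/
noncomputable def whiten (S : Matrix (Fin p) (Fin p) ℝ) :
    EuclideanSpace ℝ (Fin p) →L[ℝ] EuclideanSpace ℝ (Fin p) :=
  Matrix.toEuclideanCLM (𝕜 := ℝ) (CFC.sqrt S)⁻¹

/-- Multiplication by `Σ^{1/2}`. -/
noncomputable def colour (S : Matrix (Fin p) (Fin p) ℝ) :
    EuclideanSpace ℝ (Fin p) →L[ℝ] EuclideanSpace ℝ (Fin p) :=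
  Matrix.toEuclideanCLM (𝕜 := ℝ) (CFC.sqrt S)

lemma isUnit_det_sqrt (hS : S.PosDef) : IsUnit (CFC.sqrt S).det := by
  have h : CFC.sqrt S * CFC.sqrt S = S := CFC.sqrt_mul_sqrt_self S hS.posSemidef.nonneg
  have h2 : IsUnit S.det := hS.det_pos.ne'.isUnit
  rw [← h, Matrix.det_mul] at h2
  exact isUnit_of_mul_isUnit_left h2

lemma whiten_colour (hS : S.PosDef) (x : EuclideanSpace ℝ (Fin p)) : whiten S (colour S x) = x := by
  have : whiten S * colour S = 1 := by
    rw [whiten, colour, ← map_mul, Matrix.nonsing_inv_mul _ (isUnit_det_sqrt hS), map_one]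
  simpa using congrArg (fun f => f x) this

lemma transpose_sqrt_inv : ((CFC.sqrt S)⁻¹).transpose = (CFC.sqrt S)⁻¹ := by
  have h : (CFC.sqrt S).IsHermitian := (CFC.sqrt_nonneg S).isSelfAdjoint
  have h2 := h.inv
  rwa [Matrix.IsHermitian, Matrix.conjTranspose_eq_transpose_of_trivial] at h2

lemma norm_whiten_sq (hS : S.PosDef) (x : EuclideanSpace ℝ (Fin p)) :
    ‖whiten S x‖ ^ 2 = x.ofLp ⬝ᵥ (S⁻¹.mulVec x.ofLp) := by
  have h : CFC.sqrt S * CFC.sqrt S = S := CFC.sqrt_mul_sqrt_self S hS.posSemidef.nonneg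
  have e : S⁻¹ = (CFC.sqrt S)⁻¹ * (CFC.sqrt S)⁻¹ := by rw [← Matrix.mul_inv_rev, h]
  rw [e, ← Matrix.mulVec_mulVec, Matrix.dotProduct_mulVec, ← Matrix.mulVec_transpose,
    transpose_sqrt_inv, EuclideanSpace.real_norm_sq_eq]
  simp [whiten, dotProduct, sq]

variable {n : ℕ}

lemma dotProduct_standardizedCov_mulVec (S : Matrix (Fin p) (Fin p) ℝ)
    (X : Fin n → EuclideanSpace ℝ (Fin p)) (u : EuclideanSpace ℝ (Fin p)) :
    u.ofLp ⬝ᵥ ((standardizedCov S X).mulVec u.ofLp) =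
      (n : ℝ)⁻¹ * rowForm (fun i => whiten S (X i) - sampleMean fun j => whiten S (X j)) u := by
  have hm : ∀ i, whiten S (X i) - (sampleMean fun j => whiten S (X j)) =
      whiten S (X i - sampleMean X) := fun i => by simp [sampleMean]
  simp_rw [hm]
  have hi : ∀ y, inner ℝ u (whiten S y) = ((CFC.sqrt S)⁻¹.mulVec u.ofLp) ⬝ᵥ y.ofLp := fun y => by
    rw [← Matrix.vecMul_transpose, transpose_sqrt_inv, ← Matrix.dotProduct_mulVec]
    simp [whiten, PiLp.inner_apply, dotProduct, mul_comm]
  simp only [rowForm, hi]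
  rw [standardizedCov, ← Matrix.mulVec_mulVec, ← Matrix.mulVec_mulVec, Matrix.dotProduct_mulVec,
    ← Matrix.mulVec_transpose, transpose_sqrt_inv, sampleCov, Matrix.smul_mulVec, dotProduct_smul,
    Matrix.sum_mulVec, dotProduct_sum, smul_eq_mul]
  congr 1
  refine Finset.sum_congr rfl fun i _ => ?_
  rw [Matrix.vecMulVec_mulVec, dotProduct_smul, dotProduct_comm (X i - sampleMean X).ofLp]
  simp [sq]

/-- Needed for the real supremum to be a genuine one: for an unbounded family it defaults to 0. -/
lemma bddAbove_standardizedCov (S : Matrix (Fin p) (Fin p) ℝ)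
    (X : Fin n → EuclideanSpace ℝ (Fin p)) :
    BddAbove (Set.range fun u : {u : EuclideanSpace ℝ (Fin p) // ‖u‖ = 1} =>
      u.1.ofLp ⬝ᵥ ((standardizedCov S X).mulVec u.1.ofLp)) := by
  refine ⟨(n : ℝ)⁻¹ * ∑ i, ‖whiten S (X i) - sampleMean fun j => whiten S (X j)‖ ^ 2, ?_⟩
  rintro _ ⟨u, rfl⟩
  dsimp only
  rw [dotProduct_standardizedCov_mulVec]
  exact mul_le_mul_of_nonneg_left (rowForm_le _ u.2) (by positivity)

/-- A supremum of continuous functions is lower semicontinuous, hence measurable, even over an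
uncountable sphere. -/
lemma measurableSet_topEigenvalueTest (S : Matrix (Fin p) (Fin p) ℝ) :
    MeasurableSet (topEigenvalueTest n S) := by
  have h : LowerSemicontinuous fun X : Fin n → EuclideanSpace ℝ (Fin p) =>
      topEigenvalue (standardizedCov S X) := by
    refine lowerSemicontinuous_ciSup (bddAbove_standardizedCov S) fun u => ?_
    simp_rw [dotProduct_standardizedCov_mulVec]
    refine Continuous.lowerSemicontinuous ?_
    unfold rowForm sampleMean
    fun_prop
  exact measurableSet_le measurable_const h.measurable

/-- The rejection threshold, multiplied by the sample size. -/
lemma mul_threshold (hn : 0 < n) :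
    (n : ℝ) * (1 + (p : ℝ) / n + 12 * √((p : ℝ) / n)) = n + p + 12 * √((p : ℝ) * n) := by
  have hn' : (0 : ℝ) < n := by exact_mod_cast hn
  have e : (n : ℝ) * √((p : ℝ) / n) = √((p : ℝ) * n) := by
    conv_lhs => rw [← Real.sqrt_sq hn'.le, ← Real.sqrt_mul (by positivity)]
    congr 1; rw [Real.sqrt_sq hn'.le]; field_simp
  have e2 : (n : ℝ) * ((p : ℝ) / n) = p := by field_simp
  linear_combination 12 * e + e2

lemma exists_rowForm_gt_of_mem_test (hn : 0 < n) (hp : 0 < p)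
    {X : Fin n → EuclideanSpace ℝ (Fin p)} (hX : X ∈ topEigenvalueTest n S) {c : ℝ}
    (hc : c < n + p + 12 * √((p : ℝ) * n)) :
    ∃ u, ‖u‖ = 1 ∧
      c < rowForm (fun i => whiten S (X i) - sampleMean fun j => whiten S (X j)) u := by
  have hn' : (0 : ℝ) < n := by exact_mod_cast hn
  have : Nonempty {u : EuclideanSpace ℝ (Fin p) // ‖u‖ = 1} :=
    ⟨⟨EuclideanSpace.single ⟨0, hp⟩ 1, by simp⟩⟩
  rw [← mul_threshold hn, ← div_lt_iff₀' hn'] at hc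
  obtain ⟨u, hu⟩ := exists_lt_of_lt_ciSup (hc.trans_le hX)
  refine ⟨u.1, u.2, ?_⟩
  rw [dotProduct_standardizedCov_mulVec, ← div_eq_inv_mul] at hu
  exact (div_lt_div_iff_of_pos_right hn').1 hu

lemma rowForm_lt_of_notMem_test (hn : 0 < n)
    {X : Fin n → EuclideanSpace ℝ (Fin p)} (hX : X ∉ topEigenvalueTest n S)
    {u : EuclideanSpace ℝ (Fin p)} (hu : ‖u‖ = 1) :
    rowForm (fun i => whiten S (X i) - sampleMean fun j => whiten S (X j)) u <
      n + p + 12 * √((p : ℝ) * n) := by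
  have hn' : (0 : ℝ) < n := by exact_mod_cast hn
  simp only [topEigenvalueTest, Set.mem_ofPred_eq, not_le] at hX
  have h := (le_ciSup (bddAbove_standardizedCov S X) ⟨u, hu⟩).trans_lt hX
  dsimp only at h
  rwa [dotProduct_standardizedCov_mulVec, ← div_eq_inv_mul, div_lt_iff₀' hn', mul_threshold hn] at h

end Whitening

/-! ### Sampling as random labels plus Gaussian noise. -/

section Sampling

variable {p n : ℕ}

/-- The law of the component label; `true` stands for the second component. -/
noncomputable def labelLaw (w : ℝ) : Measure Bool :=
  ENNReal.ofReal w • Measure.dirac false + ENNReal.ofReal (1 - w) • Measure.dirac true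

lemma isProbabilityMeasure_labelLaw {w : ℝ} (hw : w ∈ Set.Ioo (0 : ℝ) 1) :
    IsProbabilityMeasure (labelLaw w) := by
  constructor
  simp [labelLaw, ← ENNReal.ofReal_add hw.1.le (sub_nonneg.2 hw.2.le)]

/-- The sample with given labels and given standard Gaussian noise. -/
noncomputable def labelledSample (θ : Param p) (β : Fin n → Bool)
    (z : Fin n → EuclideanSpace ℝ (Fin p)) : Fin n → EuclideanSpace ℝ (Fin p) :=
  fun i => (if β i then θ.mean1 else θ.mean0) + colour θ.cov (z i)

lemma mixture_eq_map (θ : Param p) :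
    θ.mixture = ((labelLaw θ.weight).prod (stdGaussian (EuclideanSpace ℝ (Fin p)))).map
      fun y => (if y.1 then θ.mean1 else θ.mean0) + colour θ.cov y.2 := by
  have hm : Measurable fun y : Bool × EuclideanSpace ℝ (Fin p) =>
      (if y.1 then θ.mean1 else θ.mean0) + colour θ.cov y.2 := by
    refine Measurable.add ?_ (by fun_prop)
    exact Measurable.ite (measurable_fst (measurableSet_singleton true)) measurable_const
      measurable_const
  rw [labelLaw, Measure.add_prod, Measure.prod_smul_left, Measure.prod_smul_left,
    Measure.dirac_prod, Measure.dirac_prod, Measure.map_add _ _ hm, Measure.map_smul,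
    Measure.map_smul, Measure.map_map hm (by fun_prop), Measure.map_map hm (by fun_prop)]
  rfl

/-- A draw from the mixture is a label and an independent Gaussian; Fubini allows the labels to be
frozen while the noise is estimated. -/
lemma sampleLaw_apply {θ : Param p} (hw : θ.weight ∈ Set.Ioo (0 : ℝ) 1)
    {s : Set (Fin n → EuclideanSpace ℝ (Fin p))} (hs : MeasurableSet s) :
    θ.sampleLaw n s = ∫⁻ β, gaussianRows n p {z | labelledSample θ β z ∈ s}
      ∂(Measure.pi fun _ : Fin n => labelLaw θ.weight) := by
  have := isProbabilityMeasure_labelLaw hw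
  have hm : Measurable fun y : Bool × EuclideanSpace ℝ (Fin p) =>
      (if y.1 then θ.mean1 else θ.mean0) + colour θ.cov y.2 := by
    refine Measurable.add ?_ (by fun_prop)
    exact Measurable.ite (measurable_fst (measurableSet_singleton true)) measurable_const
      measurable_const
  have hL : Measurable fun y : (Fin n → Bool) × (Fin n → EuclideanSpace ℝ (Fin p)) =>
      labelledSample θ y.1 y.2 := by
    refine measurable_pi_lambda _ fun i => ?_
    exact hm.comp (f := fun y : (Fin n → Bool) × (Fin n → EuclideanSpace ℝ (Fin p)) =>
      (y.1 i, y.2 i)) (by fun_prop)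
  have hmp := measurePreserving_arrowProdEquivProdArrow Bool (EuclideanSpace ℝ (Fin p)) (Fin n)
    (fun _ => labelLaw θ.weight) (fun _ => stdGaussian (EuclideanSpace ℝ (Fin p)))
  have : IsProbabilityMeasure (((labelLaw θ.weight).prod
      (stdGaussian (EuclideanSpace ℝ (Fin p)))).map
      fun y => (if y.1 then θ.mean1 else θ.mean0) + colour θ.cov y.2) :=
    Measure.isProbabilityMeasure_map hm.aemeasurable
  have key : θ.sampleLaw n = ((Measure.pi fun _ : Fin n => labelLaw θ.weight).prod
      (gaussianRows n p)).map fun y => labelledSample θ y.1 y.2 := by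
    rw [Param.sampleLaw, mixture_eq_map, ← Measure.pi_map_pi (fun _ => hm.aemeasurable),
      gaussianRows, ← hmp.map_eq, Measure.map_map hL hmp.measurable]
    rfl
  rw [key, Measure.map_apply hL hs, Measure.prod_apply (hL hs)]
  rfl

lemma whiten_labelledSample {θ : Param p} (hS : θ.cov.PosDef) (β : Fin n → Bool)
    (z : Fin n → EuclideanSpace ℝ (Fin p)) (i : Fin n) :
    whiten θ.cov (labelledSample θ β z i) =
      whiten θ.cov θ.mean0 + (z i + (if β i then (1 : ℝ) else 0) • whiten θ.cov θ.meanDiff) := by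
  simp only [labelledSample, map_add, whiten_colour hS]
  split_ifs
  · simp [Param.meanDiff]; abel
  · simp

lemma whiten_labelledSample_sub_sampleMean {θ : Param p} (hn : 0 < n) (hS : θ.cov.PosDef) (β : Fin n → Bool)
    (z : Fin n → EuclideanSpace ℝ (Fin p)) :
    (fun i => whiten θ.cov (labelledSample θ β z i) -
        sampleMean fun j => whiten θ.cov (labelledSample θ β z j)) =
      fun i => (z i + (if β i then (1 : ℝ) else 0) • whiten θ.cov θ.meanDiff) -
        sampleMean fun j => (z j + (if β j then (1 : ℝ) else 0) • whiten θ.cov θ.meanDiff) := by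
  funext i
  simp_rw [whiten_labelledSample hS]
  rw [sampleMean_add_const hn]
  abel

end Sampling

/-! ### Error under the null. -/

lemma two_mul_ofReal_exp_neg_le {m : ℝ} (hm : 0 < m) :
    2 * ENNReal.ofReal (Real.exp (-(m / 8))) ≤ ENNReal.ofReal (16 / m) := by
  rw [← ENNReal.ofReal_ofNat 2, ← ENNReal.ofReal_mul zero_le_two]
  refine ENNReal.ofReal_le_ofReal ?_
  have h : m / 8 ≤ Real.exp (m / 8) := by linarith [Real.add_one_le_exp (m / 8)]
  rw [Real.exp_neg, ← div_eq_mul_inv, div_le_div_iff₀ (Real.exp_pos _) hm]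
  linarith

lemma sampleLaw_null_le {n p : ℕ} (hn : 0 < n) (hp : 0 < p) {S : Matrix (Fin p) (Fin p) ℝ}
    (hS : S.PosDef) {θ : Param p} (hθ : θ ∈ nullSet S) :
    θ.sampleLaw n (topEigenvalueTest n S) ≤ ENNReal.ofReal (16 / (min p n : ℕ)) := by
  obtain ⟨hw, hmean, rfl⟩ := hθ
  have := isProbabilityMeasure_labelLaw hw
  have hd : θ.meanDiff = 0 := by simp [Param.meanDiff, hmean]
  have hL : 0 < √((p : ℝ) * n) := by positivity
  rw [sampleLaw_apply hw (measurableSet_topEigenvalueTest _)]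
  have hbound : ∀ β : Fin n → Bool,
      gaussianRows n p {z | labelledSample θ β z ∈ topEigenvalueTest n θ.cov} ≤
        ENNReal.ofReal (16 / (min p n : ℕ)) := fun β => by
    have hsub : {z | labelledSample θ β z ∈ topEigenvalueTest n θ.cov} ⊆
        {z : Fin n → EuclideanSpace ℝ (Fin p) |
          ∃ u, ‖u‖ = 1 ∧ (n : ℝ) + p + 11 * √((p : ℝ) * n) < rowForm z u} := fun z hz => by
      rw [Set.mem_ofPred_eq] at hz
      obtain ⟨u, hu, hlt⟩ := exists_rowForm_gt_of_mem_test hn hp hz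
        (c := n + p + 11 * √((p : ℝ) * n)) (by linarith)
      rw [whiten_labelledSample_sub_sampleMean hn hS, hd] at hlt
      simp only [map_zero, smul_zero, add_zero] at hlt
      exact ⟨u, hu, hlt.trans_le (rowForm_sub_sampleMean_le z u)⟩
    refine (measure_mono hsub).trans ?_
    -- The uniform bound needs at least as many rows as columns; for n ≤ p it is applied to the
    -- transpose, where the roles of n and p in n + p + 11√(pn) are exchanged.
    rcases le_total p n with hpn | hpn
    · rw [min_eq_left hpn]
      have h1 := (measure_exists_centeredForm_gt_le hp hpn).trans
        (two_mul_ofReal_exp_neg_le (Nat.cast_pos.2 hp))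
      refine (measure_mono fun z hz => ?_).trans h1
      obtain ⟨u, hu, h⟩ := hz
      refine ⟨u, hu, ?_⟩
      rw [centeredForm, hu]
      linarith
    · rw [min_eq_right hpn]
      have h1 := (measure_exists_centeredForm_gt_le hn hpn).trans
        (two_mul_ofReal_exp_neg_le (Nat.cast_pos.2 hn))
      rw [← gaussianRows_map_transpose n p] at h1
      refine le_trans (measure_mono fun z hz => ?_)
        ((Measure.le_map_apply measurable_transposeRows.aemeasurable _).trans h1)
      obtain ⟨u, hu, h⟩ := hz
      obtain ⟨v, hv, hle⟩ := exists_rowForm_transposeRows_ge z hu (lt_trans (by positivity) h)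
      refine ⟨v, hv, ?_⟩
      rw [centeredForm, hv, mul_comm (n : ℝ)]
      linarith
  calc _ ≤ ∫⁻ _ : Fin n → Bool, ENNReal.ofReal (16 / (min p n : ℕ))
        ∂(Measure.pi fun _ : Fin n => labelLaw θ.weight) := lintegral_mono hbound
    _ = _ := by simp

/-! ### Error under the alternative, for fixed labels. -/

lemma measure_centeredForm_le_neg_le {b a : ℕ} (hb : 0 < b)
    {v : EuclideanSpace ℝ (Fin a)} (hv : ‖v‖ = 1) {k : ℕ} (hk : 0 < k) :
    gaussianRows b a {g | centeredForm g v ≤ -√((k : ℝ) * b)} ≤ ENNReal.ofReal (4 / k) := by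
  have hb' : (0 : ℝ) < b := by exact_mod_cast hb
  have hk' : (0 : ℝ) < k := by exact_mod_cast hk
  set L := √((k : ℝ) * b) with hL
  have hL2 : L ^ 2 = k * b := Real.sq_sqrt (by positivity)
  have hL0 : 0 < L := by positivity
  -- The minimizer of bs² - sL, with minimum -k/4.
  set s := L / (2 * b) with hs
  have hs0 : 0 < s := by positivity
  have hm : Measurable fun g : Fin b → EuclideanSpace ℝ (Fin a) =>
      ENNReal.ofReal (Real.exp (-s * centeredForm g v)) := by
    unfold centeredForm rowForm
    fun_prop
  have hsub : {g : Fin b → EuclideanSpace ℝ (Fin a) | centeredForm g v ≤ -L} ⊆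
      {g | ENNReal.ofReal (Real.exp (s * L)) ≤
        ENNReal.ofReal (Real.exp (-s * centeredForm g v))} := fun g hg => by
    rw [Set.mem_ofPred_eq] at hg ⊢
    refine ENNReal.ofReal_le_ofReal (Real.exp_le_exp.2 ?_)
    nlinarith
  refine (measure_mono hsub).trans ((meas_ge_le_lintegral_div hm.aemeasurable
    (by simpa using Real.exp_pos _) ENNReal.ofReal_ne_top).trans ?_)
  refine (ENNReal.div_le_div_right (lintegral_exp_neg_mul_centeredForm_le hv.le hs0.le) _).trans ?_
  rw [← ENNReal.ofReal_div_of_pos (by positivity), ← Real.exp_sub]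
  refine ENNReal.ofReal_le_ofReal ?_
  have e : b * s ^ 2 - s * L = -(k / 4 : ℝ) := by
    have h1 : s * L = k / 2 := by rw [hs, div_mul_eq_mul_div, ← sq, hL2]; field_simp
    have h2 : (b : ℝ) * s ^ 2 = k / 4 := by rw [hs, div_pow, hL2]; field_simp; norm_num
    rw [h1, h2]; ring
  rw [e, Real.exp_neg, inv_eq_one_div, div_le_div_iff₀ (Real.exp_pos _) hk']
  linarith [Real.add_one_le_exp (k / 4 : ℝ)]

/-- `∑ᵢ vᵢ ⟨u, zᵢ⟩`. -/
noncomputable def bilinearForm {n p : ℕ} (z : Fin n → EuclideanSpace ℝ (Fin p))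
    (v : EuclideanSpace ℝ (Fin n)) (u : EuclideanSpace ℝ (Fin p)) : ℝ :=
  ∑ i, v i * inner ℝ u (z i)

/-- For unit v and u the bilinear form has mean 0 and variance 1, so this is Chebyshev. It serves
for the cross term and for the loss due to the sample mean. -/
lemma measure_bilinearForm_sq_ge_le {n p : ℕ} {v : EuclideanSpace ℝ (Fin n)} (hv : ‖v‖ = 1)
    {u : EuclideanSpace ℝ (Fin p)} (hu : ‖u‖ = 1) {c : ℝ} (hc : 0 < c) :
    gaussianRows n p {z | c ≤ bilinearForm z v u ^ 2} ≤ ENNReal.ofReal (1 / c) := by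
  set γ := stdGaussian (EuclideanSpace ℝ (Fin p)) with hγ
  have hL : MemLp (fun x => inner ℝ u x) 2 γ :=
    IsGaussian.memLp_dual γ (innerSL ℝ u) 2 (by simp)
  have hX : ∀ i : Fin n, MemLp (fun x => v i * inner ℝ u x) 2 γ := fun i => hL.const_mul _
  have hvar := variance_sum_pi (μ := fun _ : Fin n => γ) (X := fun i x => v i * inner ℝ u x) hX
  have hvu : Var[fun x => inner ℝ u x; γ] = 1 := by
    have h := variance_dual_stdGaussian (innerSL ℝ u)
    rw [innerSL_apply_norm, hu, one_pow] at h
    exact h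
  have hmu : ∫ x, inner ℝ u x ∂γ = 0 := integral_strongDual_stdGaussian (innerSL ℝ u)
  simp_rw [variance_const_mul, hvu, mul_one, ← EuclideanSpace.real_norm_sq_eq, hv, one_pow] at hvar
  have hf : (∑ i, fun ω : Fin n → EuclideanSpace ℝ (Fin p) => v i * inner ℝ u (ω i)) =
      fun z => bilinearForm z v u := by
    funext z; simp [bilinearForm]
  rw [hf] at hvar
  have hmem : MemLp (fun z : Fin n → EuclideanSpace ℝ (Fin p) => bilinearForm z v u) 2
      (gaussianRows n p) :=
    memLp_finsetSum _ fun i _ => (hX i).comp_measurePreserving (measurePreserving_eval _ i)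
  have hmean : ∫ z, bilinearForm z v u ∂gaussianRows n p = 0 := by
    unfold bilinearForm gaussianRows
    rw [integral_finsetSum _ fun i _ => integrable_comp_eval (μ := fun _ : Fin n => γ)
      (f := fun x => v i * inner ℝ u x) ((hX i).integrable one_le_two)]
    refine Finset.sum_eq_zero fun i _ => ?_
    rw [integral_comp_eval (μ := fun _ : Fin n => γ) (f := fun x => v i * inner ℝ u x)
      (hX i).aestronglyMeasurable, integral_const_mul, hmu, mul_zero]
  have h := meas_ge_le_variance_div_sq hmem (Real.sqrt_pos.2 hc)
  rw [hmean, Real.sq_sqrt hc.le] at h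
  change _ ≤ ENNReal.ofReal (Var[_; Measure.pi _] / c) at h
  rw [hvar] at h
  refine le_trans (measure_mono fun z hz => ?_) h
  rw [Set.mem_ofPred_eq] at hz ⊢
  rw [sub_zero]
  exact Real.sqrt_le_iff.2 ⟨abs_nonneg _, by rwa [sq_abs]⟩

lemma bilinearForm_eq_inner {n p : ℕ} (z : Fin n → EuclideanSpace ℝ (Fin p))
    (v : EuclideanSpace ℝ (Fin n)) (u : EuclideanSpace ℝ (Fin p)) :
    bilinearForm z v u = inner ℝ u (∑ i, v i • z i) := by
  simp [bilinearForm, inner_sum, real_inner_smul_right]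

lemma sum_mul_centered {n : ℕ} (x y : Fin n → ℝ) :
    ∑ i, (x i - (n : ℝ)⁻¹ * ∑ j, x j) * (y i - (n : ℝ)⁻¹ * ∑ j, y j) =
      ∑ i, (x i - (n : ℝ)⁻¹ * ∑ j, x j) * y i := by
  have h : ∑ i, (x i - (n : ℝ)⁻¹ * ∑ j, x j) = 0 := by
    rcases Nat.eq_zero_or_pos n with rfl | hn
    · simp
    have hn' : (n : ℝ) ≠ 0 := by positivity
    simp [Finset.sum_sub_distrib, hn']
  simp_rw [mul_sub, Finset.sum_sub_distrib, ← Finset.sum_mul, h]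
  simp

section Shifted

variable {n p : ℕ} {x : Fin n → ℝ} {δ : EuclideanSpace ℝ (Fin p)} {D : ℝ}
  {v : EuclideanSpace ℝ (Fin n)} {u₀ : EuclideanSpace ℝ (Fin p)}

/-- The form of the shifted, centered sample in the direction of the shift. -/
lemma rowForm_shift_eq (z : Fin n → EuclideanSpace ℝ (Fin p)) (hn : 0 < n)
    (hD : ∑ i, (x i - (n : ℝ)⁻¹ * ∑ j, x j) ^ 2 = D)
    (hv : ∀ i, √D * v i = x i - (n : ℝ)⁻¹ * ∑ j, x j)
    (hu : ‖u₀‖ = 1) (hδ : δ = ‖δ‖ • u₀) :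
    rowForm (fun i => (z i + x i • δ) - sampleMean fun j => z j + x j • δ) u₀ =
      rowForm z u₀ - bilinearForm z (WithLp.toLp 2 fun _ => (√n)⁻¹) u₀ ^ 2 +
        2 * (‖δ‖ * √D) * bilinearForm z v u₀ + ‖δ‖ ^ 2 * D := by
  have hn' : (n : ℝ) ≠ 0 := by positivity
  have hi : inner ℝ u₀ δ = ‖δ‖ := by
    conv_lhs => rw [hδ]
    rw [real_inner_smul_right, real_inner_self_eq_norm_sq, hu]; simp
  have e1 : ∀ i, inner ℝ u₀ ((z i + x i • δ) - sampleMean fun j => z j + x j • δ) =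
      (inner ℝ u₀ (z i) - (n : ℝ)⁻¹ * ∑ j, inner ℝ u₀ (z j)) +
        ‖δ‖ * (x i - (n : ℝ)⁻¹ * ∑ j, x j) := fun i => by
    rw [inner_sub_right, sampleMean_inner]
    simp only [inner_add_right, real_inner_smul_right, hi, Finset.sum_add_distrib,
      ← Finset.sum_mul]
    ring
  have e2 : bilinearForm z (WithLp.toLp 2 fun _ => (√n)⁻¹) u₀ ^ 2 =
      (n : ℝ)⁻¹ * (∑ j, inner ℝ u₀ (z j)) ^ 2 := by
    simp only [bilinearForm, ← Finset.mul_sum, mul_pow, inv_pow]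
    rw [Real.sq_sqrt (by positivity)]
  have e3 : √D * bilinearForm z v u₀ =
      ∑ i, (inner ℝ u₀ (z i) - (n : ℝ)⁻¹ * ∑ j, inner ℝ u₀ (z j)) *
        (x i - (n : ℝ)⁻¹ * ∑ j, x j) := by
    rw [Finset.sum_congr rfl fun i _ => mul_comm _ (x i - _), sum_mul_centered, bilinearForm,
      Finset.mul_sum]
    exact Finset.sum_congr rfl fun i _ => by rw [← hv i]; ring
  have e4 : rowForm (fun i => (z i + x i • δ) - sampleMean fun j => z j + x j • δ) u₀ =
      ∑ i, (inner ℝ u₀ (z i) - (n : ℝ)⁻¹ * ∑ j, inner ℝ u₀ (z j)) ^ 2 +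
      2 * ‖δ‖ * ∑ i, (inner ℝ u₀ (z i) - (n : ℝ)⁻¹ * ∑ j, inner ℝ u₀ (z j)) *
        (x i - (n : ℝ)⁻¹ * ∑ j, x j) +
      ‖δ‖ ^ 2 * ∑ i, (x i - (n : ℝ)⁻¹ * ∑ j, x j) ^ 2 := by
    simp only [rowForm, e1]
    generalize (n : ℝ)⁻¹ * ∑ j, inner ℝ u₀ (z j) = A
    generalize (n : ℝ)⁻¹ * ∑ j, x j = B
    rw [Finset.mul_sum, Finset.mul_sum, ← Finset.sum_add_distrib, ← Finset.sum_add_distrib]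
    exact Finset.sum_congr rfl fun i _ => by ring
  rw [e4, ← e3, hD, sum_sub_mean_sq, e2]
  simp only [rowForm]
  ring

/-- The form of the shifted, centered sample is somewhere at least the squared norm of its
combination along the centered labels. -/
lemma exists_rowForm_shift_ge (z : Fin n → EuclideanSpace ℝ (Fin p)) (hD0 : 0 < D)
    (hD : ∑ i, (x i - (n : ℝ)⁻¹ * ∑ j, x j) ^ 2 = D)
    (hv : ∀ i, √D * v i = x i - (n : ℝ)⁻¹ * ∑ j, x j) (hv1 : ‖v‖ = 1)
    (hu : ‖u₀‖ = 1) (hδ : δ = ‖δ‖ • u₀) :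
    ∃ u, ‖u‖ = 1 ∧ rowForm (transposeRows z) v + 2 * (‖δ‖ * √D) * bilinearForm z v u₀ +
        ‖δ‖ ^ 2 * D ≤
      rowForm (fun i => (z i + x i • δ) - sampleMean fun j => z j + x j • δ) u := by
  have hs : √D ^ 2 = D := Real.sq_sqrt hD0.le
  have hs0 : 0 < √D := by positivity
  set w := ∑ i, v i • z i + √D • δ with hw
  have hwn : ‖w‖ ^ 2 = rowForm (transposeRows z) v + 2 * (‖δ‖ * √D) * bilinearForm z v u₀ +
      ‖δ‖ ^ 2 * D := by
    rw [rowForm_transposeRows, hw, norm_add_sq_real, norm_smul, real_inner_smul_right,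
      bilinearForm_eq_inner, real_inner_comm δ]
    conv_lhs => rw [hδ]
    rw [real_inner_smul_left, norm_smul, hu, Real.norm_eq_abs, Real.norm_eq_abs, mul_pow, sq_abs,
      hs]
    simp only [abs_norm]
    ring
  rw [← hwn]
  by_cases hw0 : w = 0
  -- The direction of w is undefined here, but the bound to reach is 0.
  · refine ⟨u₀, hu, ?_⟩
    rw [hw0, norm_zero, zero_pow two_ne_zero]
    exact Finset.sum_nonneg fun i _ => sq_nonneg _
  have hw0' : ‖w‖ ≠ 0 := norm_ne_zero_iff.2 hw0
  refine ⟨‖w‖⁻¹ • w, by rw [norm_smul, norm_inv, norm_norm, inv_mul_cancel₀ hw0'], ?_⟩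
  set u := ‖w‖⁻¹ • w with hu'
  have e1 : ∀ i, inner ℝ u ((z i + x i • δ) - sampleMean fun j => z j + x j • δ) =
      (inner ℝ u (z i) + inner ℝ u δ * x i) -
        (n : ℝ)⁻¹ * ∑ j, (inner ℝ u (z j) + inner ℝ u δ * x j) := fun i => by
    rw [inner_sub_right, sampleMean_inner]
    simp only [inner_add_right, real_inner_smul_right]
    simp only [mul_comm]
  -- Since v sums to zero, the sample mean drops out; Cauchy–Schwarz against the unit vector v then
  -- bounds the form below by ⟨u, w⟩² = ‖w‖².
  have e2 : ∑ i, v i * inner ℝ u ((z i + x i • δ) - sampleMean fun j => z j + x j • δ) =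
      inner ℝ u w := by
    refine mul_left_cancel₀ hs0.ne' ?_
    rw [Finset.mul_sum]
    simp_rw [← mul_assoc, hv, e1]
    rw [sum_mul_centered]
    simp only [mul_add, Finset.sum_add_distrib]
    have h1 : ∑ i, (x i - (n : ℝ)⁻¹ * ∑ j, x j) * (inner ℝ u δ * x i) = inner ℝ u δ * D := by
      rw [← hD]
      simp_rw [sq, sum_mul_centered]
      generalize (n : ℝ)⁻¹ * ∑ j, x j = B
      rw [Finset.mul_sum]
      exact Finset.sum_congr rfl fun i _ => by ring
    rw [h1, hw, inner_add_right, inner_sum, mul_add]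
    simp only [real_inner_smul_right]
    congr 1
    · simp_rw [← hv, mul_assoc, ← Finset.mul_sum]
    · linear_combination -(inner ℝ u δ) * hs
  have e3 : inner ℝ u w = ‖w‖ := by
    rw [hu', real_inner_smul_left, real_inner_self_eq_norm_sq]; field_simp
  have h := Finset.sum_mul_sq_le_sq_mul_sq Finset.univ v
    fun i => inner ℝ u ((z i + x i • δ) - sampleMean fun j => z j + x j • δ)
  rw [e2, e3, ← EuclideanSpace.real_norm_sq_eq, hv1, one_pow, one_mul] at h
  exact h

lemma measure_forall_rowForm_shift_lt_le (hn : 0 < n) (hp : 0 < p) (hδ0 : δ ≠ 0) (hD0 : 0 < D)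
    (hD : ∑ i, (x i - (n : ℝ)⁻¹ * ∑ j, x j) ^ 2 = D)
    (hsignal : 32 * √((p : ℝ) * n) ≤ ‖δ‖ ^ 2 * D) :
    gaussianRows n p {z | ∀ u, ‖u‖ = 1 →
      rowForm (fun i => (z i + x i • δ) - sampleMean fun j => z j + x j • δ) u <
        n + p + 12 * √((p : ℝ) * n)} ≤ ENNReal.ofReal (7 / (min p n : ℕ)) := by
  have hn' : (0 : ℝ) < n := by exact_mod_cast hn
  have hp' : (0 : ℝ) < p := by exact_mod_cast hp
  set m := min p n with hm
  have hm0 : (0 : ℝ) < (m : ℕ) := by exact_mod_cast lt_min hp hn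
  have hmp : (m : ℝ) ≤ p := by exact_mod_cast min_le_left p n
  have hmn : (m : ℝ) ≤ n := by exact_mod_cast min_le_right p n
  set L := √((p : ℝ) * n) with hL
  have hL2 : L ^ 2 = p * n := Real.sq_sqrt (by positivity)
  have hL0 : 0 < L := by positivity
  have hmL : (m : ℝ) ≤ L := Real.le_sqrt_of_sq_le (by nlinarith)
  have hs : √D ^ 2 = D := Real.sq_sqrt hD0.le
  have hs0 : 0 < √D := by positivity
  set v : EuclideanSpace ℝ (Fin n) :=
    WithLp.toLp 2 fun i => (√D)⁻¹ * (x i - (n : ℝ)⁻¹ * ∑ j, x j) with hvdef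
  have hv : ∀ i, √D * v i = x i - (n : ℝ)⁻¹ * ∑ j, x j := fun i => by
    simp only [hvdef]; rw [mul_inv_cancel_left₀ hs0.ne']
  have hv1 : ‖v‖ = 1 := by
    have : ‖v‖ ^ 2 = 1 := by
      rw [EuclideanSpace.real_norm_sq_eq]
      simp only [hvdef, mul_pow, ← Finset.mul_sum, hD, inv_pow, hs]
      exact inv_mul_cancel₀ hD0.ne'
    exact (pow_eq_one_iff_of_nonneg (norm_nonneg _) two_ne_zero).1 this
  have hδn : ‖δ‖ ≠ 0 := norm_ne_zero_iff.2 hδ0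
  set u₀ := ‖δ‖⁻¹ • δ with hu₀
  have hu : ‖u₀‖ = 1 := by rw [hu₀, norm_smul, norm_inv, norm_norm, inv_mul_cancel₀ hδn]
  have hδ : δ = ‖δ‖ • u₀ := by rw [hu₀, smul_smul, mul_inv_cancel₀ hδn, one_smul]
  have hN := measure_bilinearForm_sq_ge_le hv1 hu (c := L / 2) (by positivity)
  -- With s = ‖δ‖√D, completing the square gives s² + 2sN ≥ s²/2 - 2N² > 16L - L.
  have hcross : ∀ {N : ℝ}, N ^ 2 < L / 2 →
      15 * L < 2 * (‖δ‖ * √D) * N + ‖δ‖ ^ 2 * D := fun {N} h => by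
    have e : (‖δ‖ * √D) ^ 2 = ‖δ‖ ^ 2 * D := by rw [mul_pow, hs]
    rw [← e] at hsignal ⊢
    nlinarith [sq_nonneg (‖δ‖ * √D + 2 * N)]
  have hbd : ∀ {t : ℝ}, (m : ℝ) ≤ t → 4 / t + (1 / (L / 2) + 1 / L) ≤ 7 / m := fun {t} ht => by
    have h1 : 4 / t ≤ 4 / m := by gcongr
    have h2 : 1 / (L / 2) + 1 / L ≤ 3 / m := by
      have : 1 / (L / 2) + 1 / L = 3 / L := by field_simp; norm_num
      rw [this]; gcongr
    calc _ ≤ 4 / (m : ℝ) + 3 / m := add_le_add h1 h2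
      _ = 7 / m := by ring
  -- For p ≤ n the form at u₀ exceeds n - L - L + 15L, and p ≤ L. For n ≤ p the centering loss is
  -- absent: the form exceeds p - L + 15L somewhere, and n ≤ L.
  rcases le_total p n with hpn | hpn
  · have hpn' : (p : ℝ) ≤ n := by exact_mod_cast hpn
    have hpL : (p : ℝ) ≤ L := Real.le_sqrt_of_sq_le (by nlinarith)
    set o : EuclideanSpace ℝ (Fin n) := WithLp.toLp 2 fun _ => (√n)⁻¹ with ho
    have ho1 : ‖o‖ = 1 := by
      have : ‖o‖ ^ 2 = 1 := by
        rw [EuclideanSpace.real_norm_sq_eq]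
        simp [ho, hn'.ne']
      exact (pow_eq_one_iff_of_nonneg (norm_nonneg _) two_ne_zero).1 this
    have hM := measure_bilinearForm_sq_ge_le ho1 hu hL0
    have hX := measure_centeredForm_le_neg_le hn hu hp
    refine le_trans (measure_mono fun z hz => ?_) ((measure_union_le _ _).trans
      ((add_le_add hX ((measure_union_le _ _).trans (add_le_add hN hM))).trans ?_))
    · rw [Set.mem_ofPred_eq] at hz
      have h := hz u₀ hu
      rw [rowForm_shift_eq z hn hD hv hu hδ] at h
      by_contra hcon
      simp only [Set.mem_union, Set.mem_ofPred_eq, not_or, not_le] at hcon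
      obtain ⟨c1, c2, c3⟩ := hcon
      rw [centeredForm, hu] at c1
      linarith [hcross c2]
    · rw [← ENNReal.ofReal_add (by positivity) (by positivity),
        ← ENNReal.ofReal_add (by positivity) (by positivity)]
      exact ENNReal.ofReal_le_ofReal (hbd hmp)
  · have hpn' : (n : ℝ) ≤ p := by exact_mod_cast hpn
    have hnL : (n : ℝ) ≤ L := Real.le_sqrt_of_sq_le (by nlinarith)
    have hX := measure_centeredForm_le_neg_le hp hv1 hn
    rw [← gaussianRows_map_transpose n p, mul_comm (n : ℝ), ← hL] at hX
    replace hX := (Measure.le_map_apply measurable_transposeRows.aemeasurable _).trans hX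
    refine le_trans (measure_mono fun z hz => ?_) ((measure_union_le _ _).trans
      ((add_le_add hX hN).trans ?_))
    · rw [Set.mem_ofPred_eq] at hz
      obtain ⟨u, hu1, h⟩ := exists_rowForm_shift_ge z hD0 hD hv hv1 hu hδ
      replace h := h.trans_lt (hz u hu1)
      by_contra hcon
      simp only [Set.mem_union, Set.mem_preimage, Set.mem_ofPred_eq, not_or, not_le] at hcon
      obtain ⟨c1, c2⟩ := hcon
      rw [centeredForm, hv1] at c1
      linarith [hcross c2]
    · rw [← ENNReal.ofReal_add (by positivity) (by positivity)]
      refine ENNReal.ofReal_le_ofReal (le_trans ?_ (hbd hmn))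
      have : 0 ≤ 1 / L := by positivity
      linarith

end Shifted

/-! ### Spread of the labels. -/

lemma integral_labelLaw {w : ℝ} (hw : w ∈ Set.Ioo (0 : ℝ) 1) (f : Bool → ℝ) :
    ∫ β, f β ∂labelLaw w = w * f false + (1 - w) * f true := by
  rw [labelLaw, integral_add_measure ((integrable_dirac (by simp)).smul_measure (by simp))
    ((integrable_dirac (by simp)).smul_measure (by simp)), integral_smul_measure,
    integral_smul_measure, integral_dirac, integral_dirac, ENNReal.toReal_ofReal hw.1.le,
    ENNReal.toReal_ofReal (sub_nonneg.2 hw.2.le)]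
  rfl

/-- With high probability the labels are about as spread out as expected. -/
lemma measure_label_spread_lt_le {n : ℕ} (hn : 0 < n) {w : ℝ} (hw : w ∈ Set.Ioo (0 : ℝ) 1) :
    (Measure.pi fun _ : Fin n => labelLaw w) {β |
      ∑ i, ((if β i then (1 : ℝ) else 0) - (n : ℝ)⁻¹ * ∑ j, if β j then (1 : ℝ) else 0) ^ 2 <
        n * (w * (1 - w)) / 2} ≤ ENNReal.ofReal (4 / (w * (1 - w)) / n) := by
  have := isProbabilityMeasure_labelLaw hw
  have hn' : (0 : ℝ) < n := by exact_mod_cast hn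
  set f : Bool → ℝ := fun β => if β then 1 else 0 with hf
  set q := w * (1 - w) with hq
  have hq0 : 0 < q := mul_pos hw.1 (sub_pos.2 hw.2)
  have hmem : MemLp f 2 (labelLaw w) := MemLp.of_discrete
  have hmean : ∫ β, f β ∂labelLaw w = 1 - w := by rw [integral_labelLaw hw]; simp [hf]
  have hvarf : Var[f; labelLaw w] = q := by
    rw [variance_eq_sub hmem, hmean]
    simp only [Pi.pow_apply]
    rw [integral_labelLaw hw]
    simp [hf, hq]
    ring
  have hvar := variance_sum_pi (μ := fun _ : Fin n => labelLaw w) (X := fun _ => f) fun _ => hmem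
  have hs : (∑ i, fun ω : Fin n → Bool => f (ω i)) = fun β => ∑ i, f (β i) := by
    funext β; simp
  rw [hs, hvarf] at hvar
  simp only [Finset.sum_const, Finset.card_univ, Fintype.card_fin, nsmul_eq_mul] at hvar
  have hmeanS : ∫ β, ∑ i, f (β i) ∂(Measure.pi fun _ : Fin n => labelLaw w) = n * (1 - w) := by
    rw [integral_finsetSum _ fun i _ => integrable_comp_eval (μ := fun _ : Fin n => labelLaw w)
      (f := f) (hmem.integrable one_le_two)]
    simp_rw [integral_comp_eval (μ := fun _ : Fin n => labelLaw w) (f := f)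
      hmem.aestronglyMeasurable, hmean]
    simp [mul_sub]
  have hmemS : MemLp (fun β : Fin n → Bool => ∑ i, f (β i)) 2
      (Measure.pi fun _ : Fin n => labelLaw w) :=
    memLp_finsetSum _ fun i _ => hmem.comp_measurePreserving (measurePreserving_eval _ i)
  have h := meas_ge_le_variance_div_sq hmemS (c := n * q / 2) (by positivity)
  rw [hvar, hmeanS] at h
  have e : (n : ℝ) * q / (n * q / 2) ^ 2 = 4 / q / n := by field_simp; norm_num
  rw [e] at h
  refine le_trans (measure_mono fun β hβ => ?_) h
  rw [Set.mem_ofPred_eq] at hβ ⊢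
  change ∑ i, (f (β i) - (n : ℝ)⁻¹ * ∑ j, f (β j)) ^ 2 < _ at hβ
  rw [sum_sub_mean_sq] at hβ
  have hsq : ∑ i, f (β i) ^ 2 = ∑ i, f (β i) :=
    Finset.sum_congr rfl fun i _ => by simp only [hf]; split_ifs <;> norm_num
  rw [hsq] at hβ
  have hx0 : 0 ≤ ∑ i, f (β i) := Finset.sum_nonneg fun i _ => by
    simp only [hf]; split_ifs <;> norm_num
  have hx1 : ∑ i, f (β i) ≤ n := by
    refine (Finset.sum_le_card_nsmul _ _ 1 fun i _ => ?_).trans (by simp)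
    simp only [hf]; split_ifs <;> norm_num
  generalize ∑ i, f (β i) = x at hβ hx0 hx1
  by_contra! hcon
  set y := (n : ℝ)⁻¹ * x with hy
  have hxy : x = n * y := by rw [hy]; field_simp
  have hy0 : 0 ≤ y := by positivity
  have hy1 : y ≤ 1 := by rw [hy, inv_mul_le_iff₀ hn']; linarith
  rw [hxy, ← mul_sub, abs_mul, abs_of_pos hn', mul_div_assoc, mul_lt_mul_iff_right₀ hn'] at hcon
  have h1 : (n : ℝ) * y - (n : ℝ)⁻¹ * (n * y) ^ 2 = n * (y - y ^ 2) := by field_simp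
  rw [hxy, h1, mul_div_assoc, mul_lt_mul_iff_right₀ hn'] at hβ
  -- The spread is ny(1 - y) with y the label frequency, and y(1 - y) - w(1 - w) = (y - (1 - w))(w -
  -- y). Hence losing half of q forces y to deviate from its mean by at least q/2.
  have h2 : |(y - (1 - w)) * (w - y)| ≤ |y - (1 - w)| * 1 := by
    rw [abs_mul]
    gcongr
    rw [abs_le]
    constructor <;> linarith [hw.1, hw.2]
  have h3 := (abs_le.1 h2).1
  have h4 : y - y ^ 2 = q + (y - (1 - w)) * (w - y) := by rw [hq]; ring
  linarith

/-! ### Assembly of the risk bound. -/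

lemma norm_whiten_meanDiff_sq {p : ℕ} {θ : Param p} (hS : θ.cov.PosDef) :
    ‖whiten θ.cov θ.meanDiff‖ ^ 2 = θ.mahalanobis :=
  norm_whiten_sq hS _

lemma sampleLaw_alt_le {n p : ℕ} (hn : 0 < n) (hp : 0 < p) {S : Matrix (Fin p) (Fin p) ℝ}
    (hS : S.PosDef) {ν r : ℝ} (hν : ν ∈ Set.Ioo (0 : ℝ) 1) (hr : 0 < r)
    (hsignal : 64 < r * ν * (1 - ν) * √((n : ℝ) / p)) {s : ℕ} {θ : Param p}
    (hθ : θ ∈ altSet s ν S Param.mahalanobis r) :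
    θ.sampleLaw n (topEigenvalueTest n S)ᶜ ≤
      ENNReal.ofReal (7 / (min p n : ℕ)) + ENNReal.ofReal (4 / (ν * (1 - ν)) / n) := by
  obtain ⟨rfl, rfl, -, hR⟩ := hθ
  have := isProbabilityMeasure_labelLaw hν
  have hn' : (0 : ℝ) < n := by exact_mod_cast hn
  have hp' : (0 : ℝ) < p := by exact_mod_cast hp
  set q := θ.weight * (1 - θ.weight) with hq
  have hq0 : 0 < q := mul_pos hν.1 (sub_pos.2 hν.2)
  set δ := whiten θ.cov θ.meanDiff with hδ
  have hδR : ‖δ‖ ^ 2 = θ.mahalanobis := norm_whiten_meanDiff_sq hS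
  have hδ0 : δ ≠ 0 := fun h => by
    rw [h, norm_zero, zero_pow two_ne_zero] at hδR
    linarith
  rw [sampleLaw_apply hν (measurableSet_topEigenvalueTest _).compl]
  set bad : Set (Fin n → Bool) := {β |
      ∑ i, ((if β i then (1 : ℝ) else 0) - (n : ℝ)⁻¹ * ∑ j, if β j then (1 : ℝ) else 0) ^ 2 <
        n * q / 2} with hbad
  have hbound : ∀ β : Fin n → Bool,
      gaussianRows n p {z | labelledSample θ β z ∈ (topEigenvalueTest n θ.cov)ᶜ} ≤
        ENNReal.ofReal (7 / (min p n : ℕ)) + bad.indicator 1 β := fun β => by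
    by_cases hβ : β ∈ bad
    · rw [Set.indicator_of_mem hβ]
      exact prob_le_one.trans le_add_self
    rw [Set.indicator_of_notMem hβ, add_zero]
    simp only [hbad, Set.mem_ofPred_eq, not_lt] at hβ
    have hD0 := (show 0 < n * q / 2 by positivity).trans_le hβ
    refine le_trans (measure_mono fun z hz => ?_)
      (measure_forall_rowForm_shift_lt_le hn hp hδ0 hD0 rfl ?_)
    · rw [Set.mem_ofPred_eq] at hz ⊢
      intro u hu
      have h := rowForm_lt_of_notMem_test hn hz hu
      rwa [whiten_labelledSample_sub_sampleMean hn hS] at h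
    -- The constant 64 is twice the 32 needed, because only half of the expected spread nq is
    -- guaranteed.
    · have h1 : r * (n * q / 2) ≤ ‖δ‖ ^ 2 * _ :=
        mul_le_mul (hδR ▸ hR) hβ (by positivity) (by positivity)
      refine le_trans ?_ h1
      have e : √((p : ℝ) * n) * √((n : ℝ) / p) = n := by
        rw [← Real.sqrt_mul (by positivity)]
        have : (p : ℝ) * n * (n / p) = n ^ 2 := by field_simp
        rw [this, Real.sqrt_sq hn'.le]
      have e2 : r * (n * q / 2) =
          √((p : ℝ) * n) / 2 * (r * θ.weight * (1 - θ.weight) * √((n : ℝ) / p)) := by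
        rw [hq]; linear_combination -(r * (θ.weight * (1 - θ.weight)) / 2) * e
      rw [e2]
      have : 0 < √((p : ℝ) * n) := by positivity
      nlinarith
  calc _ ≤ ∫⁻ β, (ENNReal.ofReal (7 / (min p n : ℕ)) + bad.indicator 1 β)
        ∂(Measure.pi fun _ : Fin n => labelLaw θ.weight) := lintegral_mono hbound
    _ = ENNReal.ofReal (7 / (min p n : ℕ)) +
        (Measure.pi fun _ : Fin n => labelLaw θ.weight) bad := by
      rw [lintegral_add_left measurable_const, lintegral_indicator_one (Set.toFinite _).measurableSet]
      simp
    _ ≤ _ := by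
      gcongr
      exact measure_label_spread_lt_le hn hν

/-- The risk of the top eigenvalue test is of order at most `1 / min p n`. -/
lemma risk_topEigenvalueTest_le {n p : ℕ} (hn : 0 < n) (hp : 0 < p)
    {S : Matrix (Fin p) (Fin p) ℝ} (hS : S.PosDef) {ν r : ℝ} (hν : ν ∈ Set.Ioo (0 : ℝ) 1)
    (hr : 0 < r) (hsignal : 64 < r * ν * (1 - ν) * √((n : ℝ) / p)) (s : ℕ) :
    risk (topEigenvalueTest n S) (nullSet S) (altSet s ν S Param.mahalanobis r) ≤
      ENNReal.ofReal ((23 + 4 / (ν * (1 - ν))) / (min p n : ℕ)) := by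
  have hn' : (0 : ℝ) < n := by exact_mod_cast hn
  have hm0 : (0 : ℝ) < (min p n : ℕ) := by exact_mod_cast lt_min hp hn
  have hmn : ((min p n : ℕ) : ℝ) ≤ n := by exact_mod_cast min_le_right p n
  have hq0 : 0 < ν * (1 - ν) := mul_pos hν.1 (sub_pos.2 hν.2)
  have h0 : ⨆ θ ∈ nullSet S, θ.sampleLaw n (topEigenvalueTest n S) ≤
      ENNReal.ofReal (16 / (min p n : ℕ)) := iSup₂_le fun θ hθ => sampleLaw_null_le hn hp hS hθ
  have h1 : ⨆ θ ∈ altSet s ν S Param.mahalanobis r, θ.sampleLaw n (topEigenvalueTest n S)ᶜ ≤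
      ENNReal.ofReal (7 / (min p n : ℕ)) + ENNReal.ofReal (4 / (ν * (1 - ν)) / n) :=
    iSup₂_le fun θ hθ => sampleLaw_alt_le hn hp hS hν hr hsignal hθ
  refine (add_le_add h0 h1).trans ?_
  have h : 4 / (ν * (1 - ν)) / n ≤ 4 / (ν * (1 - ν)) / (min p n : ℕ) := by gcongr
  generalize ((min p n : ℕ) : ℝ) = m at hm0 h ⊢
  rw [← ENNReal.ofReal_add (by positivity) (by positivity),
    ← ENNReal.ofReal_add (by positivity) (by positivity)]
  refine ENNReal.ofReal_le_ofReal ?_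
  have e : (23 + 4 / (ν * (1 - ν))) / m = 16 / m + (7 / m + 4 / (ν * (1 - ν)) / m) := by ring
  linarith

end GaussMix

theorem mainTheorem2 :
    ∃ C : ℝ, 0 < C ∧
      ∀ (ν : ℝ), ν ∈ Set.Ioo (0 : ℝ) 1 →
      ∀ (p : ℕ → ℕ), Filter.Tendsto (fun n => min (p n) n) Filter.atTop Filter.atTop →
      ∀ (S : ∀ n, Matrix (Fin (p n)) (Fin (p n)) ℝ), (∀ n, (S n).PosDef) →
      ∀ (r : ℕ → ℝ), (∀ n, 0 < r n) →
      (C : EReal) ≤ Filter.liminf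
        (fun n : ℕ => ((r n * ν * (1 - ν) * Real.sqrt ((n : ℝ) / (p n : ℝ)) : ℝ) : EReal))
        Filter.atTop →
      Filter.Tendsto
        (fun n : ℕ => GaussMix.risk (GaussMix.topEigenvalueTest n (S n))
          (GaussMix.nullSet (S n))
          (GaussMix.altSet (p n) ν (S n) GaussMix.Param.mahalanobis (r n)))
        Filter.atTop (nhds 0) := by
  -- Any constant above 64 works: a liminf of at least 65 makes the signal eventually exceed 64
  -- strictly.
  refine ⟨65, by norm_num, fun ν hν p hp S hS r hr hlim => ?_⟩
  have hev := Filter.eventually_lt_of_lt_liminf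
    (lt_of_lt_of_le (by exact_mod_cast (by norm_num : (64 : ℝ) < 65)) hlim :
      ((64 : ℝ) : EReal) < _)
  have hlim0 : Filter.Tendsto
      (fun n => ENNReal.ofReal ((23 + 4 / (ν * (1 - ν))) / (min (p n) n : ℕ)))
      Filter.atTop (nhds 0) := by
    rw [← ENNReal.ofReal_zero]
    exact ENNReal.tendsto_ofReal
      (tendsto_const_nhds.div_atTop (tendsto_natCast_atTop_atTop.comp hp))
  refine tendsto_of_tendsto_of_tendsto_of_le_of_le' tendsto_const_nhds hlim0
    (Filter.Eventually.of_forall fun _ => zero_le) ?_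
  filter_upwards [hev, hp.eventually_gt_atTop 0] with n h1 h2
  exact GaussMix.risk_topEigenvalueTest_le (h2.trans_le (min_le_right _ _))
    (h2.trans_le (min_le_left _ _)) (hS n) hν (hr n) (by exact_mod_cast h1) (p n)
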